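/- Let $n\ge 1$, let $k$ be a finite field of characteristic $p>4n$, and let $C$ be a smooth, complete, geometrically connected curve over $k$ with $C(k)\ne\emptyset$. Let $U$ be the split quadratic space of dimension $2n+2$ and discriminant $1$ over $k$, $G=\mathrm{PSO}(U)=\mathrm{SO}(U)/\mu_2\cong \mathrm{GSO}(U)/\mathbb G_m$, and let $V$ be the representation of $G$, by conjugation, on the self-adjoint operators of trace zero on $U$. Let $V^{\mathrm{reg}}\subset V$ be the open subset of the elements whose stabilizer in $G(\bar k)$ is finite. For $T\in V$ let $\Delta(T)$ be the discriminant of the characteristic polynomial of $T$, which is homogeneous of degree $(2n+1)(2n+2)$. Let $\mathcal E$ be a $G$-bundle on $C$, given by a $\mathrm{GSO}(U)$-bundle lifting it (such a lift exists and is unique up to twist by a line bundle), that is, by a vector bundle $E$ of rank $2n+2$ with a perfect symmetric bilinear form $q:E\times E\to\mathcal L$ with values in a line bundle $\mathcal L$ of degree $d$, and an orientation $\eta:\det E\otimes\mathcal L^{-(n+1)}\cong\mathcal O_C$ whose square is the discriminant of $q$. Let $\mathcal F$ be a line bundle of degree $f$ on $C$; sections of $(\mathcal E\times^G V)\otimes\mathcal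 F$ are then the $q$-self-adjoint maps $T:E\to E\otimes\mathcal F$ of trace zero, and $\Delta(T)\in H^0(C,\mathcal F^{\otimes(2n+1)(2n+2)})$. Assume that the canonical reduction of $\mathcal E$ is a reduction to the Borel subgroup, given by a filtration $0=W_0\subset W_1\subset\cdots\subset W_{n+1}\subset E$ by isotropic subbundles with $\operatorname{rk}W_i=i$. Put $X_i=W_i/W_{i-1}$ and $\mu_i=\deg X_i$ for $1\le i\le n+1$. If $$\tfrac f2<\mu_i-\mu_{i+1}\le f\ \ (1\le i\le n),\qquad \tfrac f2<2\mu_{n+1}-d\le f,\qquad 2\mu_1-d<(2n+1)f,$$ then no section of $(\mathcal E\times^G V^{\mathrm{reg}})\otimes\mathcal F$ has squarefree discriminant: for each such section $T$ there is a closed point $v$ of $C$ at which $\Delta(T)$ vanishes to order at least $2$ (possibly $\Delta(T)=0$). In other words, the number of sections of $(\mathcal E\times^G V^{\mathrm{reg}})\otimes\mathcal F$ with squarefree discriminant, i.e. the contribution of $\mathcal E$ to the count in the transversal family, is zero. -/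

import Mathlib

open CategoryTheory AlgebraicGeometry

universe u

noncomputable section

namespace CurveBundle

/-! ### Sections, local frames, line bundles, vector bundles -/

section Frames

variable {C : Scheme.{u}}

/-- The sections over `U` of an `𝒪_C`-module `M`. -/
abbrev Sec (M : C.Modules) (U : C.Opens) : Type u := M.presheaf.obj (.op U)

/-- The ring of regular functions on `U`. -/
abbrev Fun (C : Scheme.{u}) (U : C.Opens) : Type u := C.presheaf.obj (.op U)

/-- Restriction of sections of an `𝒪_C`-module. -/
def res (M : C.Modules) {U V : C.Opens} (h : V ≤ U) (s : Sec M U) : Sec M V :=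
  M.presheaf.map (homOfLE h).op s

/-- Restriction of regular functions. -/
def resFun (C : Scheme.{u}) {U V : C.Opens} (h : V ≤ U) (a : Fun C U) : Fun C V :=
  C.presheaf.map (homOfLE h).op a

/-- `e` is a frame of `M` over `U`: it induces an isomorphism `𝒪_U^ι ≅ M|_U`, that is, over every
open `V ⊆ U` each section of `M` is a unique linear combination of the restrictions of the `e i`. -/
def IsFrame {M : C.Modules} {U : C.Opens} {ι : Type} [Fintype ι] (e : ι → Sec M U) : Prop :=
  ∀ (V : C.Opens) (h : V ≤ U) (s : Sec M V),
    ∃! a : ι → Fun C V, ∑ i, a i • res M h (e i) = s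

/-- `l` generates `M` freely over `U`, i.e. it induces an isomorphism `𝒪_U ≅ M|_U`. -/
def IsGenerator {M : C.Modules} {U : C.Opens} (l : Sec M U) : Prop :=
  ∀ (V : C.Opens) (h : V ≤ U) (s : Sec M V), ∃! a : Fun C V, a • res M h l = s

/-- `M` is a vector bundle of rank `r`. -/
def IsVectorBundle (M : C.Modules) (r : ℕ) : Prop :=
  ∀ x : C, ∃ U : C.Opens, x ∈ U ∧ ∃ e : Fin r → Sec M U, IsFrame e

/-- `M` is a line bundle. -/
def IsLineBundle (M : C.Modules) : Prop :=
  ∀ x : C, ∃ U : C.Opens, x ∈ U ∧ ∃ l : Sec M U, IsGenerator l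

/-- The coordinates of a section in a frame. -/
def IsFrame.coord {M : C.Modules} {U : C.Opens} {ι : Type} [Fintype ι] {e : ι → Sec M U}
    (he : IsFrame e) (s : Sec M U) : ι → Fun C U :=
  (he U le_rfl s).choose

/-- The coordinate of a section of a line bundle with respect to a generator. -/
def IsGenerator.coord {M : C.Modules} {U : C.Opens} {l : Sec M U}
    (hl : IsGenerator l) (s : Sec M U) : Fun C U :=
  (hl U le_rfl s).choose

end Frames

/-! ### Degrees of line bundles -/

section Degree

variable {C : Scheme.{u}} [IsIntegral C]

/-- `D` is the divisor of the rational section of the line bundle `M` given by the section `s` over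
the non-empty open set `U`: if `l` generates `M` near `v` and `s = a • l` on some non-empty open
set, then `D v` is the order of vanishing at `v` of the rational function `a`. (The order is `0` at
points that are not of codimension one.) -/
def IsDivisorOf [IsLocallyNoetherian C] {M : C.Modules} {U : C.Opens} (s : Sec M U)
    (D : C → ℤ) : Prop :=
  ∀ (v : C) (W : C.Opens), v ∈ W → ∀ l : Sec M W, IsGenerator l →
    ∀ (V : C.Opens) (hVU : V ≤ U) (hVW : V ≤ W) [Nonempty V] (a : Fun C V),
      a • res M hVW l = res M hVU s → D v = Scheme.ord (C.germToFunctionField V a) v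

variable {k : Type u} [Field k] (π : C ⟶ Spec (.of k)) [LocallyOfFiniteType π]

/-- `M` has degree `d`: the divisor `D` of a non-zero rational section of `M`
has degree `∑ [κ(v) : k] D(v) = d`. -/
def HasDegree (M : C.Modules) (d : ℤ) : Prop :=
  haveI : IsLocallyNoetherian C := LocallyOfFiniteType.isLocallyNoetherian π
  ∀ (U : C.Opens) (s : Sec M U), (U : Set C).Nonempty → s ≠ 0 → ∀ D : C → ℤ, IsDivisorOf s D →
    ∑ᶠ v : C, (π.residueDegree v : ℤ) * D v = d

open Classical in
/-- The degree of a line bundle on a complete curve over a field: the common degree of the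
divisors of its non-zero rational sections. -/
def degree (M : C.Modules) : ℤ :=
  if h : ∃ d, HasDegree π M d then h.choose else 0

end Degree

/-! ### `GSO`-bundles and their reductions to the Borel subgroup -/

section Bundles

variable (C : Scheme.{u})

/-- A `GSO(2n+2)`-bundle on `C`: a vector bundle `E` of rank `2n+2` with a perfect symmetric bilinear
form `E × E → L` valued in a line bundle `L`, and an orientation, that is, an isomorphism
`η : det E ⊗ L^{-(n+1)} ≅ 𝒪_C` whose square is the discriminant of the form. Here
`orient U l` is the map `(s_1, …, s_{2n+2}) ↦ η (s_1 ∧ ⋯ ∧ s_{2n+2} ⊗ l^{-(n+1)})`. -/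
structure GSOBundle (n : ℕ) where
  E : C.Modules
  L : C.Modules
  isVectorBundle : IsVectorBundle E (2 * n + 2)
  isLineBundle : IsLineBundle L
  form : ∀ U : C.Opens, Sec E U →ₗ[Fun C U] Sec E U →ₗ[Fun C U] Sec L U
  form_res : ∀ (U V : C.Opens) (h : V ≤ U) (s t : Sec E U),
    form V (res E h s) (res E h t) = res L h (form U s t)
  form_symm : ∀ (U : C.Opens) (s t : Sec E U), form U s t = form U t s
  form_perfect : ∀ (U : C.Opens) (e : Fin (2 * n + 2) → Sec E U) (l : Sec L U),
    IsFrame e → ∀ hl : IsGenerator l,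
      IsUnit (Matrix.of fun i j => hl.coord (form U (e i) (e j))).det
  orient : ∀ (U : C.Opens) (l : Sec L U), IsGenerator l →
    (Sec E U) [⋀^Fin (2 * n + 2)]→ₗ[Fun C U] (Fun C U)
  orient_res : ∀ (U V : C.Opens) (h : V ≤ U) (l : Sec L U) (hl : IsGenerator l)
    (hl' : IsGenerator (res L h l)) (s : Fin (2 * n + 2) → Sec E U),
    orient V (res L h l) hl' (fun i => res E h (s i)) = resFun C h (orient U l hl s)
  orient_smul : ∀ (U : C.Opens) (l : Sec L U) (hl : IsGenerator l) (a : Fun C U)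
    (hl' : IsGenerator (a • l)) (s : Fin (2 * n + 2) → Sec E U),
    a ^ (n + 1) * orient U (a • l) hl' s = orient U l hl s
  orient_sq : ∀ (U : C.Opens) (e : Fin (2 * n + 2) → Sec E U) (l : Sec L U),
    IsFrame e → ∀ hl : IsGenerator l,
      (orient U l hl e) ^ 2 =
        (-1) ^ (n + 1) * (Matrix.of fun i j => hl.coord (form U (e i) (e j))).det

variable {C} {n : ℕ}

/-- The Gram matrix of the form in a frame `e` of `E` and a generator `l` of `L`. -/
def GSOBundle.gram (P : GSOBundle C n) {U : C.Opens} (e : Fin (2 * n + 2) → Sec P.E U)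
    {l : Sec P.L U} (hl : IsGenerator l) : Matrix (Fin (2 * n + 2)) (Fin (2 * n + 2)) (Fun C U) :=
  Matrix.of fun i j => hl.coord (P.form U (e i) (e j))

/-- A reduction of a `GSO(2n+2)`-bundle to the Borel subgroup: a filtration
`0 = W_0 ⊂ W_1 ⊂ ⋯ ⊂ W_{n+1} ⊂ E` by subbundles, `W_i` of rank `i`, with `W_{n+1}` isotropic,
together with the line bundles `X_i = W_{i+1} / W_i` (`0 ≤ i ≤ n`). -/
structure BorelReduction (P : GSOBundle C n) where
  W : Fin (n + 2) → ∀ U : C.Opens, Submodule (Fun C U) (Sec P.E U)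
  res_mem : ∀ (i : Fin (n + 2)) (U V : C.Opens) (h : V ≤ U) (s : Sec P.E U),
    s ∈ W i U → res P.E h s ∈ W i V
  mem_of_local : ∀ (i : Fin (n + 2)) (U : C.Opens) (s : Sec P.E U),
    (∀ x ∈ U, ∃ (V : C.Opens) (h : V ≤ U), x ∈ V ∧ res P.E h s ∈ W i V) → s ∈ W i U
  /-- Locally there is a frame of `E` whose first `i` members form a frame of `W_i`. -/
  adapted : ∀ x : C, ∃ U : C.Opens, x ∈ U ∧ ∃ e : Fin (2 * n + 2) → Sec P.E U, IsFrame e ∧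
    ∀ (i : Fin (n + 2)) (V : C.Opens) (h : V ≤ U),
      W i V = Submodule.span (Fun C V) {s | ∃ j : Fin (2 * n + 2), (j : ℕ) < (i : ℕ) ∧ s = res P.E h (e j)}
  isotropic : ∀ (U : C.Opens), ∀ s ∈ W (Fin.last (n + 1)) U, ∀ t ∈ W (Fin.last (n + 1)) U,
    P.form U s t = 0
  X : Fin (n + 1) → C.Modules
  isLineBundle : ∀ i, IsLineBundle (X i)
  /-- The quotient map `W_{i+1} → X_i`: a surjective map of sheaves with kernel `W_i`. -/
  proj : ∀ (i : Fin (n + 1)) (U : C.Opens), W i.succ U →ₗ[Fun C U] Sec (X i) U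
  proj_res : ∀ (i : Fin (n + 1)) (U V : C.Opens) (h : V ≤ U) (s : W i.succ U),
    proj i V ⟨res P.E h s.1, res_mem _ U V h s.1 s.2⟩ = res (X i) h (proj i U s)
  proj_eq_zero_iff : ∀ (i : Fin (n + 1)) (U : C.Opens) (s : W i.succ U),
    proj i U s = 0 ↔ s.1 ∈ W i.castSucc U
  proj_surj : ∀ (i : Fin (n + 1)) (U : C.Opens) (t : Sec (X i) U), ∀ x ∈ U,
    ∃ (V : C.Opens) (h : V ≤ U), x ∈ V ∧ ∃ s : W i.succ V, proj i V s = res (X i) h t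

/-- The reduction to the Borel subgroup is the canonical reduction: the line bundles associated
with the simple roots `ε_i - ε_{i+1}` and `ε_n + ε_{n+1}` have positive degrees. (The Levi quotient is
a torus, so that the semistability condition is empty.) -/
def BorelReduction.IsCanonical [IsIntegral C] {k : Type u} [Field k] (π : C ⟶ Spec (.of k))
    [LocallyOfFiniteType π] {P : GSOBundle C n} (R : BorelReduction P) : Prop :=
  (∀ i : Fin n, degree π (R.X i.succ) < degree π (R.X i.castSucc)) ∧
  (∀ i : Fin n, i.succ = Fin.last n →
    degree π P.L < degree π (R.X i.castSucc) + degree π (R.X i.succ))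

end Bundles

/-! ### Regular elements -/

section Regular

variable {F : Type u} [Field F] {ι : Type} [Fintype ι] [DecidableEq ι]

/-- The special orthogonal group of the symmetric bilinear form with matrix `B`. -/
def specialOrthogonal (B : Matrix ι ι F) : Subgroup (GL ι F) where
  carrier := {g | (g : Matrix ι ι F).transpose * B * (g : Matrix ι ι F) = B ∧
    (g : Matrix ι ι F).det = 1}
  one_mem' := by simp
  mul_mem' := by
    rintro g h ⟨hg, hg'⟩ ⟨hh, hh'⟩
    refine ⟨?_, by simp [Matrix.det_mul, hg', hh']⟩
    calc ((g * h : GL ι F) : Matrix ι ι F).transpose * B * ((g * h : GL ι F) : Matrix ι ι F)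
        = (h : Matrix ι ι F).transpose *
            ((g : Matrix ι ι F).transpose * B * (g : Matrix ι ι F)) * (h : Matrix ι ι F) := by
          simp [Matrix.transpose_mul, Matrix.mul_assoc]
      _ = B := by rw [hg, hh]
  inv_mem' := by
    rintro g ⟨hg, hg'⟩
    have h1 : (g : Matrix ι ι F) * ((g⁻¹ : GL ι F) : Matrix ι ι F) = 1 := by
      rw [← Units.val_mul, mul_inv_cancel, Units.val_one]
    refine ⟨?_, ?_⟩
    · calc ((g⁻¹ : GL ι F) : Matrix ι ι F).transpose * B * ((g⁻¹ : GL ι F) : Matrix ι ι F)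
          = ((g : Matrix ι ι F) * ((g⁻¹ : GL ι F) : Matrix ι ι F)).transpose * B *
              ((g : Matrix ι ι F) * ((g⁻¹ : GL ι F) : Matrix ι ι F)) := by
            conv_lhs => rw [← hg]
            simp only [Matrix.transpose_mul, Matrix.mul_assoc]
        _ = B := by rw [h1]; simp
    · have h2 := congrArg Matrix.det h1
      rwa [Matrix.det_mul, hg', one_mul, Matrix.det_one] at h2

/-- The subgroup `μ₂ = {±1}` of the special orthogonal group (in even dimension). -/
def muTwo (B : Matrix ι ι F) : Subgroup (specialOrthogonal B) :=
  (Subgroup.zpowers (-1 : GL ι F)).subgroupOf (specialOrthogonal B)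

/-- `T` has finite stabilizer in `PSO(B) = SO(B) / μ₂`, acting by conjugation. -/
def HasFiniteStabilizer (B T : Matrix ι ι F) : Prop :=
  Set.Finite {x : specialOrthogonal B ⧸ muTwo B |
    ∃ g : specialOrthogonal B, (g : specialOrthogonal B ⧸ muTwo B) = x ∧
      ((g : GL ι F) : Matrix ι ι F) * T * (((g : GL ι F)⁻¹ : GL ι F) : Matrix ι ι F) = T}

/-- The value at the geometric point over `v` of a matrix of regular functions near `v`. -/
def geomFiber {C : Scheme.{u}} {U : C.Opens} (v : C) (hv : v ∈ U) (A : Matrix ι ι (Fun C U)) :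
    Matrix ι ι (AlgebraicClosure (C.residueField v)) :=
  A.map fun a => algebraMap (C.residueField v) (AlgebraicClosure (C.residueField v))
    (C.evaluation U v hv a)

end Regular

/-! ### Sections of `(E ×^G V) ⊗ F` -/

section Sections

variable {C : Scheme.{u}} {n : ℕ}

/-- A global section of `(E ×^G V^reg) ⊗ F`, where `V` is the representation of `G = PSO(2n+2)` on the
self-adjoint operators of trace zero and `V^reg` is its locus of finite stabilizers. A section `T` of
`End(E) ⊗ F` is given by the endomorphisms `T_φ` of `E|_U` with `T = T_φ ⊗ φ`, where `φ` runs through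
the generators of `F` over open sets `U`. -/
structure RegularSection (P : GSOBundle C n) (F : C.Modules) where
  endo : ∀ (U : C.Opens) (φ : Sec F U), IsGenerator φ → Module.End (Fun C U) (Sec P.E U)
  endo_res : ∀ (U V : C.Opens) (h : V ≤ U) (φ : Sec F U) (hφ : IsGenerator φ)
    (hφ' : IsGenerator (res F h φ)) (s : Sec P.E U),
    endo V (res F h φ) hφ' (res P.E h s) = res P.E h (endo U φ hφ s)
  endo_smul : ∀ (U : C.Opens) (φ : Sec F U) (hφ : IsGenerator φ) (a : Fun C U)
    (hφ' : IsGenerator (a • φ)), a • endo U (a • φ) hφ' = endo U φ hφ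
  selfAdjoint : ∀ (U : C.Opens) (φ : Sec F U) (hφ : IsGenerator φ) (s t : Sec P.E U),
    P.form U (endo U φ hφ s) t = P.form U s (endo U φ hφ t)
  trace_zero : ∀ (U : C.Opens) (φ : Sec F U) (hφ : IsGenerator φ)
    (e : Fin (2 * n + 2) → Sec P.E U) (he : IsFrame e),
    (Matrix.of fun i j => he.coord (endo U φ hφ (e j)) i).trace = 0
  regular : ∀ (v : C) (U : C.Opens) (hv : v ∈ U) (φ : Sec F U) (hφ : IsGenerator φ)
    (e : Fin (2 * n + 2) → Sec P.E U) (he : IsFrame e) (l : Sec P.L U) (hl : IsGenerator l),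
    HasFiniteStabilizer (geomFiber v hv (P.gram e hl))
      (geomFiber v hv (Matrix.of fun i j => he.coord (endo U φ hφ (e j)) i))

variable {P : GSOBundle C n} {F : C.Modules}

/-- The matrix of `T` in the frame `e` of `E` and the generator `φ` of `F`. -/
def RegularSection.matrix (T : RegularSection P F) {U : C.Opens} {φ : Sec F U}
    (hφ : IsGenerator φ) {e : Fin (2 * n + 2) → Sec P.E U} (he : IsFrame e) :
    Matrix (Fin (2 * n + 2)) (Fin (2 * n + 2)) (Fun C U) :=
  Matrix.of fun i j => he.coord (T.endo U φ hφ (e j)) i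

/-- The discriminant of `T`, a section of `F^{(2n+1)(2n+2)}`, written with respect to the generator
`φ` of `F`: the discriminant of the characteristic polynomial (it does not depend on the frame). -/
def RegularSection.discriminant (T : RegularSection P F) {U : C.Opens} {φ : Sec F U}
    (hφ : IsGenerator φ) {e : Fin (2 * n + 2) → Sec P.E U} (he : IsFrame e) : Fun C U :=
  (T.matrix hφ he).charpoly.discr

/-- The discriminant of `T` is squarefree: at no closed point `v` does it vanish modulo `𝔪_v²`. (The
closed points of a curve are its points of codimension one.) -/
def RegularSection.HasSquarefreeDiscriminant (T : RegularSection P F) : Prop :=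
  ∀ v : C, Order.coheight v = 1 → ∀ (U : C.Opens) (hv : v ∈ U) (φ : Sec F U) (hφ : IsGenerator φ)
    (e : Fin (2 * n + 2) → Sec P.E U) (he : IsFrame e),
    C.presheaf.germ U v hv (T.discriminant hφ he) ∉
      IsLocalRing.maximalIdeal (C.presheaf.stalk v) ^ 2

end Sections

end CurveBundle

end

/-! The filtration extends to the complete flag `W_1 ⊂ ⋯ ⊂ W_{n+1} = W_{n+1}^⊥ ⊂ W_n^⊥ ⊂ ⋯ ⊂ E`,
whose graded pieces have degrees `μ_1, …, μ_{n+1}, d - μ_{n+1}, …, d - μ_1`; each degree is smaller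
than the preceding one by more than `f/2`. In a local frame adapted to the flag in which the form is
antidiagonal, the matrix of `T` is symmetric about the antidiagonal, because `T` is self-adjoint. An
entry `(r, s)` with only zeros to its left and below it is a section of `Hom(gr_s, gr_r) ⊗ F`, of
degree `f + deg gr_r - deg gr_s` (`hasWeightedSum_matrix_entry`). At least two steps below the
diagonal this degree is negative, so `T` is Hessenberg (`matrix_hessenberg`). The subdiagonal
entries are then sections of `2n+1` line bundles of total degree `(2n+1)f - (2μ_1 - d) > 0`, so one
of them vanishes at some closed point `v` (`exists_subdiagonal_mem_maximalIdeal`).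

The mirror image of that entry vanishes at `v` too (the middle entry is its own mirror image). Hence
modulo `𝔪_v` the matrix is block triangular, its outer diagonal blocks have the same characteristic
polynomial `A`, and that of `T` is `A² B`. If `deg A ≥ 2`, the Sylvester matrix of the polynomial
and its derivative has corank at least two at `v`, so its determinant lies in `𝔪_v²`. If `deg A =
1`, a diagonal entry `c` of `T` lifts the root of `A`, and the characteristic polynomial `χ`
satisfies `χ(c) ∈ 𝔪_v²` and `χ'(c) ∈ 𝔪_v`, which also suffices. Both cases are in
`discr_charpoly_mem_sq`.

That principal divisors have degree zero is itself extracted from `degree π F = f > 0`: a nonzero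
value shows that the degree of `F` does not depend on the section, and one compares a section with
its multiple by a rational function. -/

namespace CurveBundle
-- Discriminants in the square of an ideal
open Polynomial

/-- If the reduction of `M` modulo the maximal ideal has corank at least two, then `det M` lies in
the square of the maximal ideal. -/
theorem det_mem_maximalIdeal_sq {R : Type*} [CommRing R] [IsLocalRing R] {ι : Type*} [Fintype ι]
    [DecidableEq ι] (M : Matrix ι ι R) (v w : ι → IsLocalRing.ResidueField R)
    (hvw : ∀ a b : IsLocalRing.ResidueField R, a • v + b • w = 0 → a = 0 ∧ b = 0)
    (hv : (M.map (IsLocalRing.residue R)).mulVec v = 0)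
    (hw : (M.map (IsLocalRing.residue R)).mulVec w = 0) :
    M.det ∈ IsLocalRing.maximalIdeal R ^ 2 := by
  set N := M.map (IsLocalRing.residue R) with hN
  have hv0 : v ≠ 0 := fun h => one_ne_zero (hvw 1 0 (by simp [h])).1
  have hadj : N.adjugate = 0 := by
    ext i j
    rw [Matrix.adjugate_apply, Matrix.zero_apply]
    -- The adjugate entry is the determinant of `N` with row `j` replaced by the `i`-th unit vector.
    -- A kernel vector of `N` with vanishing `i`-th coordinate, which exists in a plane of kernel
    -- vectors, stays in the kernel.
    obtain ⟨x, hx0, hx1, hx2⟩ : ∃ x, x ≠ 0 ∧ N.mulVec x = 0 ∧ x i = 0 := by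
      by_cases h : v i = 0
      · exact ⟨v, hv0, hv, h⟩
      · refine ⟨w i • v + (-v i) • w, fun h0 => h (neg_eq_zero.mp (hvw _ _ h0).2), ?_, ?_⟩
        · rw [Matrix.mulVec_add, Matrix.mulVec_smul, Matrix.mulVec_smul, hv, hw]; simp
        · simp [mul_comm]
    refine Matrix.exists_mulVec_eq_zero_iff.mp ⟨x, hx0, ?_⟩
    ext r
    by_cases hr : r = j
    · subst hr
      simp [Matrix.mulVec, hx2]
    · have := congrFun hx1 r
      simpa [Matrix.mulVec, Matrix.updateRow_ne hr] using this
  have hadj' : ∀ i j, M.adjugate i j ∈ IsLocalRing.maximalIdeal R := by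
    intro i j
    rw [← IsLocalRing.residue_eq_zero_iff]
    have : (IsLocalRing.residue R).mapMatrix M.adjugate = 0 := by
      rw [RingHom.map_adjugate]; exact hadj
    exact congrFun (congrFun this i) j
  obtain ⟨i, hi⟩ : ∃ i, v i ≠ 0 := by
    by_contra! h
    exact hv0 (funext h)
  choose u hu using fun i => IsLocalRing.residue_surjective (R := R) (v i)
  have hMu : ∀ k, M.mulVec u k ∈ IsLocalRing.maximalIdeal R := by
    intro k
    rw [← IsLocalRing.residue_eq_zero_iff, RingHom.map_mulVec,
      show (IsLocalRing.residue R) ∘ u = v from funext hu]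
    exact congrFun hv k
  -- Both factors on the right lie in the maximal ideal, and `u i` is a unit.
  have key : M.det * u i = ∑ k, M.adjugate i k * M.mulVec u k := by
    have := congrArg (fun A => Matrix.mulVec A u i) (Matrix.adjugate_mul M)
    simp only [← Matrix.mulVec_mulVec, Matrix.smul_mulVec, Matrix.one_mulVec] at this
    exact this.symm
  have hui : IsUnit (u i) := by
    by_contra h
    exact hi (by rw [← hu, IsLocalRing.residue_eq_zero_iff]; exact h)
  rw [← Ideal.mul_unit_mem_iff_mem _ hui, key, pow_two]
  exact Ideal.sum_mem _ fun k _ => Ideal.mul_mem_mul (hadj' i k) (hMu k)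

/-- For monic `f` the resultant with the derivative is the discriminant up to sign. -/
theorem discr_mem_of_resultant_mem {R : Type*} [CommRing R] (I : Ideal R) {f : R[X]} (hf : f.Monic)
    (hdeg : 0 < f.natDegree)
    (h : resultant f f.derivative f.natDegree (f.natDegree - 1) ∈ I) : f.discr ∈ I := by
  rw [resultant_deriv (natDegree_pos_iff_degree_pos.mp hdeg), hf.leadingCoeff, mul_one] at h
  rwa [Ideal.unit_mul_mem_iff_mem _ (IsUnit.pow _ (isUnit_one.neg))] at h

/-- A monic polynomial whose reduction is divisible by the square of a polynomial of degree at least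
two has its discriminant in the square of the maximal ideal. -/
theorem discr_mem_sq_of_sq_dvd {R : Type*} [CommRing R] [IsLocalRing R] {f : R[X]} (hf : f.Monic)
    {A B : (IsLocalRing.ResidueField R)[X]} (hA : A.Monic) (hdeg : 2 ≤ A.natDegree)
    (h : f.map (IsLocalRing.residue R) = A ^ 2 * B) :
    f.discr ∈ IsLocalRing.maximalIdeal R ^ 2 := by
  have hB : B.Monic := by
    have := hf.map (IsLocalRing.residue R)
    rw [h] at this
    exact (hA.pow 2).of_mul_monic_left this
  have hN : f.natDegree = 2 * A.natDegree + B.natDegree := by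
    rw [← hf.natDegree_map (IsLocalRing.residue R), h, (hA.pow 2).natDegree_mul hB,
      hA.natDegree_pow]
  set N := f.natDegree with hNdef
  refine discr_mem_of_resultant_mem _ hf (by lia) ?_
  rw [← hNdef]
  set g := f.map (IsLocalRing.residue R) with hg
  have hgN : g.natDegree ≤ N := natDegree_map_le
  have hg'N : g.derivative.natDegree ≤ N - 1 := (natDegree_derivative_le g).trans (by lia)
  set b := (((degreeLT.basis (IsLocalRing.ResidueField R) N).prod
    (degreeLT.basis (IsLocalRing.ResidueField R) (N - 1))).reindex finSumFinEquiv) with hb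
  have hS : (sylvester f f.derivative N (N - 1)).map (IsLocalRing.residue R) =
      (sylvesterMap g g.derivative hgN hg'N).toMatrix b (degreeLT.basis _ _) := by
    rw [toMatrix_sylvesterMap', hg, derivative_map, sylvester_map_map]; rfl
  -- Since `g' = A (2A'B + AB')`, the pair `(AB, D)` is a syzygy of `g'` and `g`. Its multiples by
  -- `1` and by `X` still meet the degree bounds because `deg A ≥ 2`; they are two independent
  -- kernel vectors of the Sylvester matrix.
  set D := -(2 * derivative A * B + A * derivative B) with hD
  have hCdeg : D.natDegree + A.natDegree ≤ N - 1 := by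
    rw [hD, natDegree_neg]
    have h1 : (2 * derivative A * B).natDegree ≤ A.natDegree - 1 + B.natDegree := by
      refine natDegree_mul_le.trans (Nat.add_le_add_right ?_ _)
      refine natDegree_mul_le.trans ?_
      have := natDegree_derivative_le A
      have h2 : (2 : (IsLocalRing.ResidueField R)[X]).natDegree = 0 := natDegree_ofNat 2
      lia
    have h3 : (A * derivative B).natDegree ≤ A.natDegree + B.natDegree - 1 := by
      by_cases hB0 : B.natDegree = 0
      · rw [natDegree_eq_zero] at hB0
        obtain ⟨c, rfl⟩ := hB0
        simp
      · refine natDegree_mul_le.trans ?_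
        have := natDegree_derivative_le B
        lia
    have := natDegree_add_le (2 * derivative A * B) (A * derivative B)
    have h4 := this.trans (max_le_max h1 h3)
    have : max (A.natDegree - 1 + B.natDegree) (A.natDegree + B.natDegree - 1) =
      A.natDegree + B.natDegree - 1 := by lia
    lia
  have hAB : (A * B).natDegree = A.natDegree + B.natDegree := hA.natDegree_mul hB
  have hzero : g * D + g.derivative * (A * B) = 0 := by
    rw [h, hD]; rw [pow_two]; simp only [derivative_mul]; ring
  have mem1 : ∀ r : (IsLocalRing.ResidueField R)[X], r.natDegree ≤ 1 →
      A * B * r ∈ degreeLT (IsLocalRing.ResidueField R) N := by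
    intro r hr
    rw [mem_degreeLT]
    refine degree_le_natDegree.trans_lt ?_
    have := natDegree_mul_le (p := A * B) (q := r)
    exact_mod_cast (by lia : (A * B * r).natDegree < N)
  have mem2 : ∀ r : (IsLocalRing.ResidueField R)[X], r.natDegree ≤ 1 →
      D * r ∈ degreeLT (IsLocalRing.ResidueField R) (N - 1) := by
    intro r hr
    rw [mem_degreeLT]
    refine degree_le_natDegree.trans_lt ?_
    have := natDegree_mul_le (p := D) (q := r)
    exact_mod_cast (by lia : (D * r).natDegree < N - 1)
  let z : ∀ r : (IsLocalRing.ResidueField R)[X], r.natDegree ≤ 1 →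
      degreeLT (IsLocalRing.ResidueField R) N × degreeLT (IsLocalRing.ResidueField R) (N - 1) :=
    fun r hr => (⟨_, mem1 r hr⟩, ⟨_, mem2 r hr⟩)
  have hz : ∀ r hr, (sylvesterMap g g.derivative hgN hg'N) (z r hr) = 0 := by
    intro r hr
    ext1
    simp only [sylvesterMap_apply_coe, z]
    rw [← mul_assoc, ← mul_assoc, ← add_mul, hzero]; simp
  have hker : ∀ r hr, ((sylvester f f.derivative N (N - 1)).map (IsLocalRing.residue R)).mulVec
      (b.repr (z r hr)) = 0 := by
    intro r hr
    rw [hS, LinearMap.toMatrix_mulVec_repr, hz r hr]; simp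
  have hX : (X : (IsLocalRing.ResidueField R)[X]).natDegree ≤ 1 := natDegree_X_le
  have h1 : (1 : (IsLocalRing.ResidueField R)[X]).natDegree ≤ 1 := by simp
  refine det_mem_maximalIdeal_sq _ _ _ ?_ (hker 1 h1) (hker X hX)
  intro s t hst
  have h5 : s • z 1 h1 + t • z X hX = 0 := by
    apply b.repr.injective
    ext i
    simpa using congrFun hst i
  have h6 : A * B * (C s + Polynomial.C t * X) = 0 := by
    have := congrArg (fun y => (y.1 : (IsLocalRing.ResidueField R)[X])) h5
    simp only [z] at this
    have h7 : s • (A * B * 1) + t • (A * B * X) = 0 := this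
    rw [← h7, smul_eq_C_mul, smul_eq_C_mul]; ring
  have h8 := ((hA.mul hB).mul_right_eq_zero_iff).mp h6
  exact ⟨by simpa using congrArg (fun q => q.coeff 0) h8,
    by simpa using congrArg (fun q => q.coeff 1) h8⟩

/-- If a monic polynomial `f` vanishes at `c` modulo `I ^ 2` and its derivative vanishes at `c`
modulo `I`, then its discriminant lies in `I ^ 2`. -/
theorem discr_mem_sq_of_eval {R : Type*} [CommRing R] (I : Ideal R) {f : R[X]} (hf : f.Monic)
    (hdeg : 2 ≤ f.natDegree) (c : R) (h0 : f.eval c ∈ I ^ 2) (h1 : f.derivative.eval c ∈ I) :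
    f.discr ∈ I ^ 2 := by
  refine discr_mem_of_resultant_mem _ hf (by lia) ?_
  set φ := Ideal.Quotient.mk (I ^ 2) with hφ
  rw [← Ideal.Quotient.eq_zero_iff_mem, ← hφ, ← resultant_map_map, ← derivative_map]
  by_cases htriv : Nontrivial (R ⧸ I ^ 2)
  swap
  · rw [not_nontrivial_iff_subsingleton] at htriv
    exact Subsingleton.elim _ _
  set g := f.map φ with hg
  have hgm : g.Monic := hf.map φ
  have hgN : f.natDegree = g.natDegree := (hf.natDegree_map φ).symm
  have hroot : g.eval (φ c) = 0 := by
    rw [hg, eval_map_apply, Ideal.Quotient.eq_zero_iff_mem]; exact h0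
  obtain ⟨Q, hQ⟩ := dvd_iff_isRoot.mpr hroot
  have hQm : Q.Monic := (monic_X_sub_C _).of_mul_monic_left (hQ ▸ hgm)
  have hQN : g.natDegree = 1 + Q.natDegree := by
    rw [hQ, (monic_X_sub_C _).natDegree_mul hQm, natDegree_X_sub_C]
  -- With `g = (X - c) Q` one gets `Res(g, g') = g'(c) · Res(Q, g')`, and modulo `Q` the second
  -- factor is `Res(Q, (X - c) Q')`, a multiple of `Q(c) = g'(c)`. So `g'(c)²` divides the
  -- resultant.
  have hg' : g.derivative = (X - C (φ c)) * Q.derivative + Q * 1 := by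
    rw [hQ, derivative_mul]; simp; ring
  have hev : g.derivative.eval (φ c) = φ (f.derivative.eval c) := by
    rw [hg, derivative_map, eval_map_apply]
  have hQev : Q.eval (φ c) = φ (f.derivative.eval c) := by
    rw [← hev, hg']; simp
  have hd : g.derivative.natDegree ≤ Q.natDegree := by
    have := natDegree_derivative_le g; lia
  rw [hgN, hQN, Nat.add_sub_cancel_left]
  have e1 := resultant_mul_left (X - C (φ c)) Q g.derivative Q.natDegree hd
  rw [natDegree_X_sub_C, ← hQ, resultant_X_sub_C_left _ _ _ hd, hev] at e1
  rw [e1]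
  have hQ' := natDegree_derivative_le Q
  have e2 : resultant Q g.derivative Q.natDegree Q.natDegree =
      φ (f.derivative.eval c) * ((-1) ^ Q.natDegree *
        resultant Q Q.derivative Q.natDegree Q.derivative.natDegree) := by
    rw [hg', resultant_add_mul_right _ _ _ _ _ (by simp) le_rfl]
    -- The degree of `Q'` can be less than `deg Q - 1`; `k` is the defect. Padding the formal degree
    -- costs only a sign and a power of the leading coefficient of `Q`, which is `1`.
    obtain ⟨k, hk⟩ := Nat.exists_eq_add_of_le
      (show 1 + Q.derivative.natDegree ≤ Q.natDegree by lia)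
    have e3 := resultant_mul_right Q (X - C (φ c)) Q.derivative Q.natDegree le_rfl
    rw [natDegree_X_sub_C] at e3
    have hm : ((X - C (φ c)) * Q.derivative).natDegree ≤ 1 + Q.derivative.natDegree := by
      exact natDegree_mul_le.trans (by rw [natDegree_X_sub_C])
    have e4 := resultant_add_right_deg Q ((X - C (φ c)) * Q.derivative) Q.natDegree _ k hm
    rw [← hk, e3, resultant_X_sub_C_right _ _ _ le_rfl, hQev] at e4
    rw [e4, hQm.coeff_natDegree]; ring
  rw [e2, ← mul_assoc, ← map_mul, Ideal.Quotient.eq_zero_iff_mem.mpr, zero_mul]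
  rw [pow_two]; exact Ideal.mul_mem_mul h1 h1

end CurveBundle

/-! ### Hessenberg matrices symmetric about the antidiagonal -/

namespace CurveBundle
open Polynomial

/-- Every term of the Leibniz expansion contains either the entry `(r, s)` itself or two different
factors, one from row `r` and one from column `s`. -/
theorem det_mem_sq_of_row_of_col {R : Type*} [CommRing R] (I : Ideal R) {ι : Type*} [Fintype ι]
    [DecidableEq ι] (B : Matrix ι ι R) (r s : ι) (hr : ∀ j, B r j ∈ I) (hs : ∀ i, B i s ∈ I)
    (hrs : B r s ∈ I ^ 2) : B.det ∈ I ^ 2 := by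
  rw [Matrix.det_apply]
  refine Ideal.sum_mem _ fun σ _ => ?_
  suffices h : ∏ i, B (σ i) i ∈ I ^ 2 by
    rcases Int.units_eq_one_or (Equiv.Perm.sign σ) with h1 | h1 <;> simp [h1, h]
  by_cases hσ : σ s = r
  · rw [← Finset.mul_prod_erase Finset.univ _ (Finset.mem_univ s)]
    exact Ideal.mul_mem_right _ _ (by rwa [hσ])
  · have hne : σ⁻¹ r ≠ s := fun h => hσ (by rw [← h]; simp)
    rw [← Finset.mul_prod_erase Finset.univ _ (Finset.mem_univ s),
      ← Finset.mul_prod_erase _ _ (Finset.mem_erase.mpr ⟨hne, Finset.mem_univ _⟩), ← mul_assoc]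
    refine Ideal.mul_mem_right _ _ ?_
    rw [pow_two]
    exact Ideal.mul_mem_mul (hs _) (by simpa using hr _)

/-- A Hessenberg matrix over a local ring that is symmetric about the antidiagonal and has a
subdiagonal entry in the maximal ideal has the discriminant of its characteristic polynomial in the
square of the maximal ideal. -/
theorem discr_charpoly_mem_sq {R : Type*} [CommRing R] [IsLocalRing R] {N : ℕ} (hN : 4 ≤ N)
    (M : Matrix (Fin N) (Fin N) R) (hess : ∀ i j : Fin N, (j : ℕ) + 2 ≤ i → M i j = 0)
    (persym : ∀ i j, M i.rev j.rev = M j i) (i j : Fin N) (hij : (j : ℕ) + 1 = i)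
    (h : M i j ∈ IsLocalRing.maximalIdeal R) :
    M.charpoly.discr ∈ IsLocalRing.maximalIdeal R ^ 2 := by
  -- The antidiagonal symmetry exchanges the entry with its mirror image, so it may be taken in the
  -- upper half.
  wlog hi : 2 * (i : ℕ) ≤ N generalizing i j
  · exact this j.rev i.rev (by simp only [Fin.val_rev]; lia) (by rwa [persym])
      (by simp only [Fin.val_rev]; lia)
  have hdeg : M.charpoly.natDegree = N := by simp [Matrix.charpoly_natDegree_eq_dim]
  -- For `i = 1` the repeated factor is linear and the reduction alone gives only one order of
  -- vanishing; the second comes from the corner entry being zero in `R` itself.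
  rcases (show (i : ℕ) = 1 ∨ 2 ≤ (i : ℕ) by lia) with hi1 | hi2
  · have hj : j = ⟨0, by lia⟩ := Fin.ext (by simp; lia)
    have hcol : ∀ r : Fin N, r ≠ j → M r j ∈ IsLocalRing.maximalIdeal R := by
      intro r hr
      by_cases hri : r = i
      · rwa [hri]
      · rw [hess r j]
        · exact Ideal.zero_mem _
        · have h1 : (r : ℕ) ≠ j := fun h => hr (Fin.ext h)
          have h2 : (r : ℕ) ≠ i := fun h => hri (Fin.ext h)
          lia
    have hrow : ∀ s : Fin N, s ≠ j.rev → M j.rev s ∈ IsLocalRing.maximalIdeal R := by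
      intro s hs
      have := persym j s.rev
      rw [Fin.rev_rev] at this
      rw [this]
      exact hcol _ fun h => hs (by rw [← h, Fin.rev_rev])
    have hdiag : M j.rev j.rev = M j j := persym j j
    have hjrev : j.rev ≠ j := fun h => by
      have := congrArg Fin.val h; simp only [Fin.val_rev] at this; lia
    have hcorner : M j.rev j = 0 := hess _ _ (by simp only [Fin.val_rev]; lia)
    refine discr_mem_sq_of_eval _ M.charpoly_monic (by lia) (M j j) ?_ ?_
    · rw [Matrix.eval_charpoly]
      refine det_mem_sq_of_row_of_col _ _ j.rev j ?_ ?_ ?_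
      · intro s
        by_cases hs : s = j.rev
        · subst hs; simp [hdiag]
        · simpa [Matrix.sub_apply, Matrix.scalar_apply, Matrix.diagonal_apply_ne' _ hs]
            using hrow s hs
      · intro r
        by_cases hr : r = j
        · subst hr; simp
        · simpa [Matrix.sub_apply, Matrix.scalar_apply, Matrix.diagonal_apply_ne _ hr]
            using hcol r hr
      · simp [Matrix.sub_apply, Matrix.scalar_apply, Matrix.diagonal_apply_ne _ hjrev, hcorner]
    · set φ := IsLocalRing.residue R with hφ
      rw [← IsLocalRing.residue_eq_zero_iff, ← hφ, ← eval_map_apply, ← derivative_map,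
        ← Matrix.charpoly_map]
      -- The same row-and-column argument, now for the characteristic matrix over the residue field
      -- and the ideal `(X - c)`: the polynomial has a double root, so its derivative vanishes
      -- there.
      have : (M.map φ).charpoly ∈ Ideal.span {X - C (φ (M j j))} ^ 2 := by
        refine det_mem_sq_of_row_of_col _ _ j.rev j ?_ ?_ ?_
        · intro s
          by_cases hs : s = j.rev
          · subst hs
            rw [Matrix.charmatrix_apply_eq, Matrix.map_apply, hdiag]
            exact Ideal.subset_span rfl
          · rw [Matrix.charmatrix_apply_ne _ _ _ (Ne.symm hs), Matrix.map_apply,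
              (IsLocalRing.residue_eq_zero_iff _).mpr (hrow s hs)]
            simp
        · intro r
          by_cases hr : r = j
          · subst hr
            rw [Matrix.charmatrix_apply_eq, Matrix.map_apply]
            exact Ideal.subset_span rfl
          · rw [Matrix.charmatrix_apply_ne _ _ _ hr, Matrix.map_apply,
              (IsLocalRing.residue_eq_zero_iff _).mpr (hcol r hr)]
            simp
        · rw [Matrix.charmatrix_apply_ne _ _ _ hjrev, Matrix.map_apply, hcorner]
          simp
      rw [Ideal.span_singleton_pow, Ideal.mem_span_singleton] at this
      obtain ⟨Q, hQ⟩ := this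
      rw [hQ, pow_two]
      simp [derivative_mul]
  · set φ := IsLocalRing.residue R with hφ
    -- Blocks of sizes `i`, `N - 2i`, `i`; the middle one is empty when `N = 2i`. The only entries
    -- below the blocks not killed by the Hessenberg condition are `(i, j)` and its mirror image.
    let b : Fin N → Fin 3 := fun r => if (r : ℕ) < i then 0 else if (r : ℕ) < N - i then 1 else 2
    have hbr : ∀ r, b r = 0 ↔ (r : ℕ) < i := by
      intro r; simp only [b]; split_ifs <;> simp_all
    have hbr2 : ∀ r, b r = 2 ↔ N - (i : ℕ) ≤ r := by
      intro r; simp only [b]; split_ifs <;> simp_all <;> lia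
    have hzero : ∀ r s, b s < b r → φ (M r s) = 0 := by
      intro r s hrs
      have hlt : (s : ℕ) < r := by
        by_contra! hle
        simp only [b] at hrs
        split_ifs at hrs <;> lia
      by_cases h2 : (s : ℕ) + 2 ≤ r
      · rw [hess r s h2, map_zero]
      · rw [IsLocalRing.residue_eq_zero_iff]
        by_cases h3 : (r : ℕ) = i
        · rwa [show r = i from Fin.ext h3, show s = j from Fin.ext (by lia)]
        · have h4 : (r : ℕ) = N - i := by
            simp only [b] at hrs
            split_ifs at hrs <;> lia
          rw [show r = j.rev from Fin.ext (by simp only [Fin.val_rev]; lia),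
            show s = i.rev from Fin.ext (by simp only [Fin.val_rev]; lia), persym]
          exact h
    have hbt : (M.map φ).charmatrix.BlockTriangular b := by
      intro r s hrs
      rw [Matrix.charmatrix_apply_ne _ _ _ (fun h => by simp [h] at hrs), Matrix.map_apply,
        hzero r s hrs]
      simp
    have hdet := hbt.det_fintype
    rw [Fin.prod_univ_three] at hdet
    -- Index reversal exchanges the outer blocks and, by the symmetry, turns one into the transpose
    -- of the other.
    let e : {r // b r = 0} ≃ {r // b r = 2} :=
      { toFun := fun r => ⟨r.1.rev, by
          have := (hbr _).mp r.2; rw [hbr2, Fin.val_rev]; lia⟩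
        invFun := fun r => ⟨r.1.rev, by
          have := (hbr2 _).mp r.2; have := r.1.2; rw [hbr, Fin.val_rev]; lia⟩
        left_inv := fun r => by simp
        right_inv := fun r => by simp }
    have h02 : ((M.map φ).charmatrix.toSquareBlock b 2).det =
        ((M.map φ).charmatrix.toSquareBlock b 0).det := by
      rw [← Matrix.det_submatrix_equiv_self e, ← Matrix.det_transpose]
      congr 1
      ext1 r s
      simp only [Matrix.transpose_apply, Matrix.submatrix_apply, Matrix.toSquareBlock_def,
        Matrix.of_apply]
      change (M.map φ).charmatrix s.1.rev r.1.rev = (M.map φ).charmatrix r.1 s.1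
      by_cases hrs : r = s
      · subst hrs
        rw [Matrix.charmatrix_apply_eq, Matrix.charmatrix_apply_eq, Matrix.map_apply, persym,
          Matrix.map_apply]
      · have h1 : r.1 ≠ s.1 := fun h => hrs (Subtype.ext h)
        rw [Matrix.charmatrix_apply_ne _ _ _ h1, Matrix.charmatrix_apply_ne _ _ _
          (fun h => h1 (Fin.rev_injective h).symm), Matrix.map_apply, persym, Matrix.map_apply]
    have h00 : (M.map φ).charmatrix.toSquareBlock b 0 =
        ((M.map φ).toSquareBlock b 0).charmatrix := by
      ext1 r s
      by_cases hrs : r = s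
      · subst hrs
        simp [Matrix.toSquareBlock_def, Matrix.charmatrix_apply_eq]
      · have h1 : r.1 ≠ s.1 := fun h => hrs (Subtype.ext h)
        rw [Matrix.charmatrix_apply_ne _ _ _ hrs, Matrix.toSquareBlock_def, Matrix.of_apply,
          Matrix.charmatrix_apply_ne _ _ _ h1]
        rfl
    refine discr_mem_sq_of_sq_dvd M.charpoly_monic
      (A := ((M.map φ).toSquareBlock b 0).charpoly)
      (B := ((M.map φ).charmatrix.toSquareBlock b 1).det)
      (Matrix.charpoly_monic _) ?_ ?_
    · rw [Matrix.charpoly_natDegree_eq_dim]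
      let e2 : Fin 2 → {r // b r = 0} := fun t => ⟨⟨t, by lia⟩, (hbr _).mpr (by simp; lia)⟩
      have : Function.Injective e2 := fun s t hst => by
        simpa [e2, Fin.ext_iff] using hst
      simpa using Fintype.card_le_of_injective e2 this
    · rw [← Matrix.charpoly_map]
      change (M.map φ).charmatrix.det = _
      rw [hdet, h02, h00, Matrix.charpoly]
      ring

end CurveBundle

/-! ### Orders of vanishing and weighted sums of divisors -/

namespace CurveBundle

section Orders

variable {C : Scheme.{u}} [IsIntegral C]

theorem eq_of_coheight_eq_one_of_specializes {v z : C} (hv : Order.coheight v = 1) (hzv : z ⤳ v)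
    (hz : z ≠ genericPoint C) : v = z := by
  have h1 : v ≤ z := hzv
  have hη : genericPoint C ⤳ z := (genericPoint_spec C).specializes trivial
  have h2 : z < genericPoint C := lt_iff_le_not_ge.mpr
    ⟨hη, fun h => hz ((show z ⤳ genericPoint C from h).antisymm hη).eq⟩
  by_contra hne
  have h3 : v < z := lt_iff_le_not_ge.mpr
    ⟨h1, fun h => hne ((show v ⤳ z from h).antisymm hzv).eq⟩
  have h4 := Order.coheight_add_one_le h2
  have h5 := Order.coheight_add_one_le h3
  rw [hv] at h5
  have h6 : (1 : ℕ∞) + 1 ≤ 1 := by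
    calc (1 : ℕ∞) + 1 ≤ (Order.coheight (genericPoint C) + 1) + 1 := by gcongr; simp
      _ ≤ Order.coheight z + 1 := by gcongr
      _ ≤ 1 := h5
  exact absurd h6 (by decide)

/-- The complement of `U` has finitely many irreducible components, and a point of codimension one
outside `U` must be the generic point of one of them. -/
theorem finite_coheight_eq_one_notMem [IsNoetherian C] (U : C.Opens) [Nonempty U] :
    {v : C | Order.coheight v = 1 ∧ v ∉ U}.Finite := by
  obtain ⟨S, hSf, hS, hSU⟩ :=
    TopologicalSpace.NoetherianSpace.exists_finite_set_isClosed_irreducible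
    (α := C) (s := (U : Set C)ᶜ) U.isOpen.isClosed_compl
  choose! z hz using fun (Z : Set C) (hZ : IsIrreducible Z ∧ IsClosed Z) =>
    QuasiSober.sober hZ.1 hZ.2
  refine (hSf.image z).subset ?_
  rintro v ⟨hv, hvU⟩
  have : v ∈ ⋃₀ S := by rw [← hSU.2]; exact hvU
  obtain ⟨Z, hZS, hvZ⟩ := this
  have hzZ := hz Z ⟨hSU.1 Z hZS, hS Z hZS⟩
  refine ⟨Z, hZS, (eq_of_coheight_eq_one_of_specializes hv (hzZ.specializes hvZ) ?_).symm⟩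
  intro h
  have h1 : z Z ∈ (U : Set C)ᶜ := by rw [hSU.2]; exact ⟨Z, hZS, hzZ.mem⟩
  rw [h] at h1
  exact h1 (((genericPoint_spec C).mem_open_set_iff U.isOpen).mpr
    (by simpa using ‹Nonempty U›))

/-- A nonzero rational function is a unit on some non-empty open set. -/
theorem ord_support_finite [IsNoetherian C] (f : C.functionField) :
    (Function.support (Scheme.ord f)).Finite := by
  by_cases hf : f = 0
  · simp [hf]
  obtain ⟨U, -, a, hU, rfl, ha⟩ := exists_isUnit_germ_eq C f hf
  refine (finite_coheight_eq_one_notMem U).subset fun v hv => ⟨?_, fun hvU => ?_⟩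
  · by_contra h
    exact hv (Scheme.ord_eq_zero_of_coheight_neq_one h _)
  · exact hv (Scheme.ord_of_isUnit ha hvU)

variable [IsLocallyNoetherian C]

theorem ord_one (v : C) : Scheme.ord (1 : C.functionField) v = 0 := by
  have := Scheme.ord_mul (x := v) (one_ne_zero (α := C.functionField)) one_ne_zero
  rw [mul_one] at this
  lia

theorem ord_inv {f : C.functionField} (hf : f ≠ 0) (v : C) :
    Scheme.ord f⁻¹ v = - Scheme.ord f v := by
  have := Scheme.ord_mul (x := v) hf (inv_ne_zero hf)
  rw [mul_inv_cancel₀ hf, ord_one] at this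
  lia

theorem ord_germ_nonneg {U : C.Opens} [Nonempty U] (a : Fun C U) {v : C} (hv : v ∈ U) :
    0 ≤ Scheme.ord (C.germToFunctionField U a) v := by
  by_cases ha : a = 0
  · simp [ha]
  have := Scheme.ord_le_smul hv ha (1 : C.functionField)
  rwa [ord_one, Algebra.smul_def, mul_one] at this

theorem ord_germ_eq_zero_of_isUnit_germ {U : C.Opens} [Nonempty U] (a : Fun C U) {v : C}
    (hv : v ∈ U) (ha : IsUnit (C.presheaf.germ U v hv a)) :
    Scheme.ord (C.germToFunctionField U a) v = 0 := by
  have hvB : v ∈ C.basicOpen a := (C.mem_basicOpen a v hv).mpr ha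
  have : Nonempty (C.basicOpen a) := ⟨⟨v, hvB⟩⟩
  have hu : IsUnit (resFun C (C.basicOpen_le a) a) := C.toRingedSpace.isUnit_res_basicOpen a
  rw [← Scheme.ord_of_isUnit hu hvB]
  congr 1
  exact (C.presheaf.germ_res_apply (homOfLE (C.basicOpen_le a)) _ _ a).symm

theorem germ_mem_maximalIdeal_of_ord_pos {U : C.Opens} [Nonempty U] (a : Fun C U) {v : C}
    (hv : v ∈ U) (ha : 0 < Scheme.ord (C.germToFunctionField U a) v) :
    C.presheaf.germ U v hv a ∈ IsLocalRing.maximalIdeal (C.presheaf.stalk v) := by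
  by_contra h
  have := ord_germ_eq_zero_of_isUnit_germ a hv (by simpa using h)
  lia

end Orders

section WeightedSums

variable {α : Type*}

/-- `D` has finite support and weighted degree `d`. -/
def HasWeightedSum (wt D : α → ℤ) (d : ℤ) : Prop :=
  (Function.support D).Finite ∧ ∑ᶠ v, wt v * D v = d

variable {wt D D' : α → ℤ} {d d' : ℤ}

theorem HasWeightedSum.add (h : HasWeightedSum wt D d) (h' : HasWeightedSum wt D' d') :
    HasWeightedSum wt (D + D') (d + d') := by
  refine ⟨(h.1.union h'.1).subset (Function.support_add _ _), ?_⟩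
  simp only [Pi.add_apply, mul_add]
  rw [finsum_add_distrib, h.2, h'.2]
  · exact h.1.subset (Function.support_mul_subset_right _ _)
  · exact h'.1.subset (Function.support_mul_subset_right _ _)

theorem HasWeightedSum.neg (h : HasWeightedSum wt D d) : HasWeightedSum wt (-D) (-d) := by
  refine ⟨by rw [Function.support_neg]; exact h.1, ?_⟩
  simp only [Pi.neg_apply, mul_neg]
  rw [finsum_neg_distrib, h.2]

theorem HasWeightedSum.sub (h : HasWeightedSum wt D d) (h' : HasWeightedSum wt D' d') :
    HasWeightedSum wt (D - D') (d - d') := by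
  rw [sub_eq_add_neg, sub_eq_add_neg]; exact h.add h'.neg

theorem HasWeightedSum.nonneg (h : HasWeightedSum wt D d) (hwt : ∀ v, 0 ≤ wt v)
    (hD : ∀ v, 0 ≤ D v) : 0 ≤ d := by
  rw [← h.2]; exact finsum_nonneg fun v => mul_nonneg (hwt v) (hD v)

theorem HasWeightedSum.exists_ne_zero (h : HasWeightedSum wt D d) (hd : d ≠ 0) : ∃ v, D v ≠ 0 := by
  by_contra! hD
  exact hd (by rw [← h.2]; simp [hD])

end WeightedSums

end CurveBundle

/-! ### Restriction, gluing and frames -/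

namespace CurveBundle

section Restriction

variable {C : Scheme.{u}} (M : C.Modules) {U V W : C.Opens}

@[simp] theorem res_zero (h : V ≤ U) : res M h (0 : Sec M U) = 0 := map_zero _

@[simp] theorem res_smul (h : V ≤ U) (a : Fun C U) (s : Sec M U) :
    res M h (a • s) = resFun C h a • res M h s :=
  Scheme.Modules.map_smul M _ _ _

@[simp] theorem res_sum {ι : Type*} (h : V ≤ U) (t : Finset ι) (s : ι → Sec M U) :
    res M h (∑ i ∈ t, s i) = ∑ i ∈ t, res M h (s i) :=
  map_sum (M.presheaf.map (homOfLE h).op).hom s t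

@[simp] theorem res_res (h : V ≤ U) (h' : W ≤ V) (s : Sec M U) :
    res M h' (res M h s) = res M (h'.trans h) s := by
  unfold res
  rw [← ConcreteCategory.comp_apply, ← Functor.map_comp]
  rfl

@[simp] theorem res_rfl (s : Sec M U) : res M le_rfl s = s := by
  unfold res
  rw [show (homOfLE (le_refl U)).op = 𝟙 _ from rfl, CategoryTheory.Functor.map_id]
  rfl

@[simp] theorem resFun_mul (h : V ≤ U) (a b : Fun C U) :
    resFun C h (a * b) = resFun C h a * resFun C h b := map_mul _ _ _

@[simp] theorem resFun_zero (h : V ≤ U) : resFun C h (0 : Fun C U) = 0 := map_zero _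

@[simp] theorem resFun_resFun (h : V ≤ U) (h' : W ≤ V) (a : Fun C U) :
    resFun C h' (resFun C h a) = resFun C (h'.trans h) a := by
  unfold resFun
  rw [← ConcreteCategory.comp_apply, ← Functor.map_comp]
  rfl

theorem resFun_injective [IsIntegral C] (h : V ≤ U) [Nonempty V] :
    Function.Injective (resFun C h) :=
  map_injective_of_isIntegral C (homOfLE h)

theorem germToFunctionField_resFun [IsIntegral C] (h : V ≤ U) [Nonempty U] [Nonempty V]
    (a : Fun C U) : C.germToFunctionField V (resFun C h a) = C.germToFunctionField U a :=
  C.presheaf.germ_res_apply (homOfLE h) _ _ a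

variable {M} in
/-- Sections of a module that agree locally agree. -/
theorem sec_ext {s t : Sec M U}
    (h : ∀ x ∈ U, ∃ (V : C.Opens) (hV : V ≤ U), x ∈ V ∧ res M hV s = res M hV t) : s = t := by
  choose V hV hx hst using h
  refine TopCat.Sheaf.eq_of_locally_eq' (⟨M.presheaf, M.isSheaf⟩ : TopCat.Sheaf Ab C)
    (fun x : U => V x.1 x.2) U (fun x => homOfLE (hV x.1 x.2)) ?_ s t (fun x => hst x.1 x.2)
  intro x hxU
  exact TopologicalSpace.Opens.mem_iSup.mpr ⟨⟨x, hxU⟩, hx x hxU⟩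

/-- A regular function can be constructed locally if it is unique locally. -/
theorem exists_fun_of_local (p : ∀ V : C.Opens, V ≤ U → Fun C V → Prop)
    (hres : ∀ V W hV (hWV : W ≤ V) a, p V hV a → p W (hWV.trans hV) (resFun C hWV a))
    (huniq : ∀ V hV a b, p V hV a → p V hV b → a = b)
    (hloc : ∀ x ∈ U, ∃ (V : C.Opens) (hV : V ≤ U), x ∈ V ∧ ∃ a, p V hV a) :
    ∃ a : Fun C U, ∀ x ∈ U, ∃ (V : C.Opens) (hV : V ≤ U), x ∈ V ∧ p V hV (resFun C hV a) := by
  choose V hV hx a ha using hloc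
  obtain ⟨b, hb, -⟩ := TopCat.Sheaf.existsUnique_gluing' C.sheaf
    (fun x : U => V x.1 x.2) U (fun x => homOfLE (hV x.1 x.2)) (by
      intro x hxU
      exact TopologicalSpace.Opens.mem_iSup.mpr ⟨⟨x, hxU⟩, hx x hxU⟩) (fun x => a x.1 x.2)
    (fun x y => huniq _ (inf_le_left.trans (hV x.1 x.2)) _ _
      (hres _ _ _ inf_le_left _ (ha x.1 x.2)) (hres _ _ _ inf_le_right _ (ha y.1 y.2)))
  refine ⟨b, fun x hxU => ⟨V x hxU, hV x hxU, hx x hxU, ?_⟩⟩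
  have : resFun C (hV x hxU) b = a x hxU := hb ⟨x, hxU⟩
  rw [this]
  exact ha x hxU

end Restriction

section FrameLemmas

variable {C : Scheme.{u}} {M : C.Modules} {U V : C.Opens}

theorem IsGenerator.restrict {l : Sec M U} (hl : IsGenerator l) (h : V ≤ U) :
    IsGenerator (res M h l) := by
  intro W hW s
  simpa using hl W (hW.trans h) s

theorem IsGenerator.smul_injective {l : Sec M U} (hl : IsGenerator l) {a b : Fun C U}
    (h : a • l = b • l) : a = b :=
  (hl U le_rfl (a • l)).unique (by simp) (by simp [h])

theorem IsGenerator.exists_smul_eq {l : Sec M U} (hl : IsGenerator l) (s : Sec M U) :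
    ∃ a : Fun C U, a • l = s := by
  obtain ⟨a, ha, -⟩ := hl U le_rfl s
  exact ⟨a, by simpa using ha⟩

theorem IsGenerator.coord_smul {l : Sec M U} (hl : IsGenerator l) (s : Sec M U) :
    hl.coord s • l = s := by
  have : hl.coord s • res M le_rfl l = s := (hl U le_rfl s).choose_spec.1
  rwa [res_rfl] at this

theorem IsGenerator.ne_zero [Nonempty U] {l : Sec M U} (hl : IsGenerator l) : l ≠ 0 := by
  rintro rfl
  exact one_ne_zero (hl.smul_injective (a := 1) (b := 0) (by simp))

/-- The ratio of two generators is a unit. -/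
theorem IsGenerator.exists_unit {l l' : Sec M U} (hl : IsGenerator l) (hl' : IsGenerator l') :
    ∃ a : Fun C U, IsUnit a ∧ a • l = l' := by
  obtain ⟨a, ha⟩ := hl.exists_smul_eq l'
  obtain ⟨b, hb⟩ := hl'.exists_smul_eq l
  refine ⟨a, IsUnit.of_mul_eq_one b (hl'.smul_injective ?_), ha⟩
  rw [mul_smul, hb, ha, one_smul]

variable {ι : Type} [Fintype ι]

theorem IsFrame.restrict {e : ι → Sec M U} (he : IsFrame e) (h : V ≤ U) :
    IsFrame fun i => res M h (e i) := by
  intro W hW s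
  simpa using he W (hW.trans h) s

theorem IsFrame.sum_injective {e : ι → Sec M U} (he : IsFrame e) {a b : ι → Fun C U}
    (h : ∑ i, a i • e i = ∑ i, b i • e i) : a = b :=
  (he U le_rfl (∑ i, a i • e i)).unique (by simp) (by simp [h])

theorem IsFrame.sum_coord {e : ι → Sec M U} (he : IsFrame e) (s : Sec M U) :
    ∑ i, he.coord s i • e i = s := by
  have : ∑ i, he.coord s i • res M le_rfl (e i) = s := (he U le_rfl s).choose_spec.1
  simpa only [res_rfl] using this

theorem IsFrame.coord_eq_of_sum_eq {e : ι → Sec M U} (he : IsFrame e) {s : Sec M U}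
    {a : ι → Fun C U} (h : ∑ i, a i • e i = s) : he.coord s = a :=
  he.sum_injective (by rw [he.sum_coord, h])

theorem IsFrame.coord_res {e : ι → Sec M U} (he : IsFrame e) (h : V ≤ U) (s : Sec M U) (i : ι) :
    (he.restrict h).coord (res M h s) i = resFun C h (he.coord s i) := by
  rw [(he.restrict h).coord_eq_of_sum_eq (a := fun i => resFun C h (he.coord s i))]
  conv_rhs => rw [← he.sum_coord s]
  simp

/-- The change of a frame by an invertible matrix is a frame. -/
theorem IsFrame.mul_matrix [DecidableEq ι] {e : ι → Sec M U} (he : IsFrame e)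
    (Q Q' : Matrix ι ι (Fun C U)) (hQ : Q * Q' = 1) :
    IsFrame fun j => ∑ i, Q i j • e i := by
  have hQ' : Q' * Q = 1 := mul_eq_one_comm.mp hQ
  intro W hW s
  set f := fun i => res M hW (e i) with hf
  have hfr : IsFrame f := he.restrict hW
  let ρ : Fun C U →+* Fun C W := (C.presheaf.map (homOfLE hW).op).hom
  have hρ : ∀ a, resFun C hW a = ρ a := fun a => rfl
  have key : ∀ a : ι → Fun C W, ∑ j, a j • res M hW (∑ i, Q i j • e i) =
      ∑ i, ((Q.map ρ).mulVec a) i • f i := by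
    intro a
    simp only [res_sum, res_smul, hρ, Finset.smul_sum, smul_smul, Matrix.mulVec, dotProduct,
      Finset.sum_smul, Matrix.map_apply]
    rw [Finset.sum_comm]
    simp only [mul_comm, hf]
  have h1 : Q.map ρ * Q'.map ρ = 1 := by
    rw [← Matrix.map_mul, hQ]; simp
  have h2 : Q'.map ρ * Q.map ρ = 1 := by
    rw [← Matrix.map_mul, hQ']; simp
  refine ⟨(Q'.map ρ).mulVec (hfr.coord s), ?_, ?_⟩
  · change ∑ j, _ = _
    rw [key, Matrix.mulVec_mulVec, h1, Matrix.one_mulVec, hfr.sum_coord]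
  · intro a ha
    change ∑ j, _ = _ at ha
    rw [key] at ha
    rw [hfr.coord_eq_of_sum_eq ha, Matrix.mulVec_mulVec, h2, Matrix.one_mulVec]

end FrameLemmas

end CurveBundle

/-! ### Rational sections, divisors and degrees -/

namespace CurveBundle

section Ratios

variable {C : Scheme.{u}} [IsIntegral C] {M : C.Modules} {U U' U'' : C.Opens}

theorem nonempty_inf (U V : C.Opens) [hU : Nonempty U] [hV : Nonempty V] :
    Nonempty (U ⊓ V : C.Opens) := by
  have h : ∀ W : C.Opens, Nonempty W → genericPoint C ∈ W := fun W hW =>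
    ((genericPoint_spec C).mem_open_set_iff W.isOpen).mpr (by simpa using hW)
  exact ⟨⟨genericPoint C, h U hU, h V hV⟩⟩

/-- The rational section `m'` is `r` times the rational section `m`. -/
def IsRatio (m : Sec M U) (m' : Sec M U') (r : C.functionField) : Prop :=
  ∃ (V : C.Opens) (h : V ≤ U) (h' : V ≤ U') (_ : Nonempty V) (a : Fun C V),
    a • res M h m = res M h' m' ∧ C.germToFunctionField V a = r

theorem IsRatio.trans {m : Sec M U} {m' : Sec M U'} {m'' : Sec M U''} {r r' : C.functionField}
    (h : IsRatio m m' r) (h' : IsRatio m' m'' r') : IsRatio m m'' (r * r') := by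
  obtain ⟨V, h1, h2, hV, a, ha, rfl⟩ := h
  obtain ⟨V', h1', h2', hV', a', ha', rfl⟩ := h'
  have := nonempty_inf V V'
  refine ⟨V ⊓ V', inf_le_left.trans h1, inf_le_right.trans h2', this,
    resFun C inf_le_left a * resFun C inf_le_right a', ?_, ?_⟩
  · have e1 := congrArg (res M (inf_le_left : V ⊓ V' ≤ V)) ha
    have e2 := congrArg (res M (inf_le_right : V ⊓ V' ≤ V')) ha'
    simp only [res_smul, res_res] at e1 e2
    rw [← e2, ← e1, smul_smul, mul_comm]
  · rw [map_mul, germToFunctionField_resFun, germToFunctionField_resFun]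

theorem IsRatio.unique {l : Sec M U} (hl : IsGenerator l) {s : Sec M U'} {r r' : C.functionField}
    (h : IsRatio l s r) (h' : IsRatio l s r') : r = r' := by
  obtain ⟨V, h1, h2, hV, a, ha, rfl⟩ := h
  obtain ⟨V', h1', h2', hV', a', ha', rfl⟩ := h'
  have := nonempty_inf V V'
  rw [← germToFunctionField_resFun (inf_le_left : V ⊓ V' ≤ V),
    ← germToFunctionField_resFun (inf_le_right : V ⊓ V' ≤ V')]
  congr 1
  refine (hl.restrict ((inf_le_left : V ⊓ V' ≤ V).trans h1)).smul_injective ?_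
  have e1 := congrArg (res M (inf_le_left : V ⊓ V' ≤ V)) ha
  have e2 := congrArg (res M (inf_le_right : V ⊓ V' ≤ V')) ha'
  simp only [res_smul, res_res] at e1 e2
  rw [e1, e2]

theorem IsGenerator.exists_ratio {l : Sec M U} (hl : IsGenerator l) (s : Sec M U')
    [Nonempty U] [Nonempty U'] : ∃ r, IsRatio l s r := by
  have := nonempty_inf U U'
  obtain ⟨a, ha⟩ := (hl.restrict (inf_le_left : U ⊓ U' ≤ U)).exists_smul_eq
    (res M (inf_le_right : U ⊓ U' ≤ U') s)
  exact ⟨_, _, inf_le_left, inf_le_right, this, a, ha, rfl⟩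

theorem IsRatio.refl [h : Nonempty U] (l : Sec M U) : IsRatio l l 1 :=
  ⟨U, le_rfl, le_rfl, h, 1, by simp, map_one _⟩

theorem IsRatio.symm {l : Sec M U} {l' : Sec M U'} (hl : IsGenerator l) (hl' : IsGenerator l')
    [Nonempty U] [Nonempty U'] {r : C.functionField} (h : IsRatio l l' r) :
    IsRatio l' l r⁻¹ := by
  obtain ⟨r', h'⟩ := hl'.exists_ratio l
  have := (h.trans h').unique hl (IsRatio.refl l)
  rwa [eq_inv_of_mul_eq_one_right this] at h'

theorem IsRatio.ne_zero {l : Sec M U} {l' : Sec M U'} (hl : IsGenerator l) (hl' : IsGenerator l')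
    [Nonempty U] [Nonempty U'] {r : C.functionField} (h : IsRatio l l' r) : r ≠ 0 := by
  have := (h.trans (h.symm hl hl')).unique hl (IsRatio.refl l)
  exact left_ne_zero_of_mul_eq_one this

theorem eq_zero_of_res_eq_zero (hM : IsLineBundle M) {V : C.Opens} (h : V ≤ U) [Nonempty V]
    {s : Sec M U} (hs : res M h s = 0) : s = 0 := by
  refine sec_ext fun x hx => ?_
  obtain ⟨W, hxW, l, hl⟩ := hM x
  refine ⟨U ⊓ W, inf_le_left, ⟨hx, hxW⟩, ?_⟩
  have : Nonempty (U ⊓ W : C.Opens) := ⟨⟨x, hx, hxW⟩⟩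
  have := nonempty_inf (U ⊓ W) V
  have hl' := hl.restrict (inf_le_right : U ⊓ W ≤ W)
  obtain ⟨a, ha⟩ := hl'.exists_smul_eq (res M (inf_le_left : U ⊓ W ≤ U) s)
  have ha0 : a = 0 := by
    apply resFun_injective (inf_le_left : U ⊓ W ⊓ V ≤ U ⊓ W)
    refine (hl'.restrict (inf_le_left : U ⊓ W ⊓ V ≤ U ⊓ W)).smul_injective ?_
    have e1 := congrArg (res M (inf_le_left : U ⊓ W ⊓ V ≤ U ⊓ W)) ha
    have e2 := congrArg (res M (inf_le_right : U ⊓ W ⊓ V ≤ V)) hs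
    simp only [res_smul, res_res, res_zero] at e1 e2
    simp [e1, e2]
  rw [← ha, ha0]; simp

theorem IsRatio.ne_zero_of_section (hM : IsLineBundle M) {l : Sec M U} {s : Sec M U'}
    {r : C.functionField} (h : IsRatio l s r) (hs : s ≠ 0) : r ≠ 0 := by
  rintro rfl
  obtain ⟨V, h1, h2, hV, a, ha, h0⟩ := h
  refine hs (eq_zero_of_res_eq_zero hM h2 ?_)
  rw [← ha, (map_eq_zero_iff _ (C.germToFunctionField_injective V)).mp h0, zero_smul]

theorem IsRatio.ord_eq_zero [IsLocallyNoetherian C] {l : Sec M U} {l' : Sec M U'}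
    (hl : IsGenerator l) (hl' : IsGenerator l') {r : C.functionField} (h : IsRatio l l' r) {v : C}
    (hv : v ∈ U) (hv' : v ∈ U') : Scheme.ord r v = 0 := by
  have hne : Nonempty (U ⊓ U' : C.Opens) := ⟨⟨v, hv, hv'⟩⟩
  obtain ⟨a, hau, ha⟩ := (hl.restrict (inf_le_left : U ⊓ U' ≤ U)).exists_unit
    (hl'.restrict (inf_le_right : U ⊓ U' ≤ U'))
  rw [h.unique hl ⟨_, inf_le_left, inf_le_right, hne, a, ha, rfl⟩]
  exact Scheme.ord_of_isUnit hau ⟨hv, hv'⟩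

theorem isDivisorOf_iff [IsLocallyNoetherian C] (s : Sec M U) (D : C → ℤ) :
    IsDivisorOf s D ↔ ∀ (v : C) (W : C.Opens), v ∈ W → ∀ l : Sec M W, IsGenerator l →
      ∀ r, IsRatio l s r → D v = Scheme.ord r v := by
  constructor
  · rintro h v W hv l hl r ⟨V, h1, h2, hV, a, ha, rfl⟩
    exact h v W hv l hl V h2 h1 a ha
  · intro h v W hv l hl V h2 h1 hV a ha
    exact h v W hv l hl _ ⟨V, h1, h2, hV, a, ha, rfl⟩

/-- Two generators near `v` differ by a unit, so one generator at each point suffices to test a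
divisor. -/
theorem isDivisorOf_of_exists [IsLocallyNoetherian C] (s : Sec M U) (D : C → ℤ)
    (h : ∀ v : C, ∃ (W : C.Opens) (_ : v ∈ W) (l : Sec M W) (_ : IsGenerator l) (r : _),
      IsRatio l s r ∧ r ≠ 0 ∧ D v = Scheme.ord r v) : IsDivisorOf s D := by
  rw [isDivisorOf_iff]
  intro v W' hv' l' hl' r' hr'
  obtain ⟨W, hv, l, hl, r, hr, hr0, hD⟩ := h v
  have : Nonempty W := ⟨⟨v, hv⟩⟩
  have : Nonempty W' := ⟨⟨v, hv'⟩⟩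
  obtain ⟨t, ht⟩ := hl'.exists_ratio l
  rw [hr'.unique hl' (ht.trans hr), Scheme.ord_mul (ht.ne_zero hl' hl) hr0,
    ht.ord_eq_zero hl' hl hv' hv, zero_add, hD]

theorem IsLineBundle.exists_divisor [IsLocallyNoetherian C] (hM : IsLineBundle M) [Nonempty U]
    {s : Sec M U} (hs : s ≠ 0) : ∃ D, IsDivisorOf s D := by
  choose W hW l hl using hM
  have hne : ∀ v, Nonempty (W v) := fun v => ⟨⟨v, hW v⟩⟩
  choose r hr using fun v => (hl v).exists_ratio s
  exact ⟨fun v => Scheme.ord (r v) v, isDivisorOf_of_exists _ _ fun v =>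
    ⟨W v, hW v, l v, hl v, r v, hr v, (hr v).ne_zero_of_section
      (fun x => ⟨W x, hW x, l x, hl x⟩) hs, rfl⟩⟩

theorem IsDivisorOf.support_finite [IsNoetherian C] (hM : IsLineBundle M) [Nonempty U]
    {s : Sec M U} {D : C → ℤ} (hD : IsDivisorOf s D) : (Function.support D).Finite := by
  rw [isDivisorOf_iff] at hD
  choose W hW l hl using hM
  have hne : ∀ v, Nonempty (W v) := fun v => ⟨⟨v, hW v⟩⟩
  choose r hr using fun v => (hl v).exists_ratio s
  obtain ⟨t, ht⟩ := isCompact_univ.elim_finite_subcover (fun v => (W v : Set C))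
    (fun v => (W v).isOpen) (fun v _ => Set.mem_iUnion.mpr ⟨v, hW v⟩)
  refine (t.finite_toSet.biUnion fun x _ => ord_support_finite (r x)).subset fun v hv => ?_
  obtain ⟨x, hx, hvx⟩ := Set.mem_iUnion₂.mp (ht (Set.mem_univ v))
  refine Set.mem_biUnion hx ?_
  rw [Function.mem_support, ← hD v (W x) hvx (l x) (hl x) (r x) (hr x)]
  exact hv

theorem IsDivisorOf.of_ratio [IsLocallyNoetherian C] (hM : IsLineBundle M) [Nonempty U]
    [Nonempty U'] {m : Sec M U} {s : Sec M U'} (hm : m ≠ 0) {D D' : C → ℤ} (hD : IsDivisorOf m D)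
    (hD' : IsDivisorOf s D') {g : C.functionField} (hg : g ≠ 0) (h : IsRatio m s g) :
    D' = D + Scheme.ord g := by
  rw [isDivisorOf_iff] at hD hD'
  ext v
  obtain ⟨W, hv, l, hl⟩ := hM v
  have : Nonempty W := ⟨⟨v, hv⟩⟩
  obtain ⟨r, hr⟩ := hl.exists_ratio m
  rw [Pi.add_apply, hD v W hv l hl r hr, hD' v W hv l hl _ (hr.trans h),
    Scheme.ord_mul (hr.ne_zero_of_section hM hm) hg]

theorem exists_generator_nonempty {M : C.Modules} (hM : IsLineBundle M) :
    ∃ (U : C.Opens) (_ : Nonempty U) (l : Sec M U), IsGenerator l := by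
  obtain ⟨U, hU, l, hl⟩ := hM (genericPoint C)
  exact ⟨U, ⟨⟨_, hU⟩⟩, l, hl⟩

end Ratios

section Degrees

variable {C : Scheme.{u}} [IsIntegral C] [IsNoetherian C] {k : Type u} [Field k]
  (π : C ⟶ Spec (.of k)) [LocallyOfFiniteType π]

/-- Principal divisors have degree zero. -/
def PrincipalDegreeZero : Prop :=
  ∀ g : C.functionField, g ≠ 0 →
    HasWeightedSum (fun v => (π.residueDegree v : ℤ)) (Scheme.ord g) 0

variable {π}

/-- As soon as one line bundle has a well-defined degree, principal divisors have degree zero. -/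
theorem HasDegree.principalDegreeZero {M : C.Modules} (hM : IsLineBundle M) {d : ℤ}
    (hd : HasDegree π M d) : PrincipalDegreeZero π := by
  intro g hg
  refine ⟨ord_support_finite g, ?_⟩
  obtain ⟨U, hU, m, hm⟩ := exists_generator_nonempty hM
  obtain ⟨V, -, a, hV, rfl, -⟩ := exists_isUnit_germ_eq C g hg
  have hUV := nonempty_inf U V
  -- The rational section `g • m`; its divisor is that of `m` plus that of `g`, and both sections
  -- have degree `d`.
  set s : Sec M (U ⊓ V) := resFun C (inf_le_right : U ⊓ V ≤ V) a •
    res M (inf_le_left : U ⊓ V ≤ U) m with hs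
  have hr : IsRatio m s (C.germToFunctionField V a) :=
    ⟨U ⊓ V, inf_le_left, le_rfl, hUV, resFun C inf_le_right a, by simp [hs],
      germToFunctionField_resFun _ _⟩
  have hs0 : s ≠ 0 := by
    intro h0
    have : resFun C (inf_le_right : U ⊓ V ≤ V) a = 0 :=
      (hm.restrict (inf_le_left : U ⊓ V ≤ U)).smul_injective (by rw [← hs, h0, zero_smul])
    refine hg ?_
    rw [← germToFunctionField_resFun (inf_le_right : U ⊓ V ≤ V), this, map_zero]
  obtain ⟨D, hD⟩ := hM.exists_divisor hm.ne_zero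
  obtain ⟨D', hD'⟩ := hM.exists_divisor hs0
  have e1 := hd U m (Set.nonempty_coe_sort.mp hU) hm.ne_zero D hD
  have e2 := hd _ s (Set.nonempty_coe_sort.mp hUV) hs0 D' hD'
  have h1 : HasWeightedSum (fun v => (π.residueDegree v : ℤ)) D d := ⟨hD.support_finite hM, e1⟩
  have h2 : HasWeightedSum (fun v => (π.residueDegree v : ℤ)) D' d := ⟨hD'.support_finite hM, e2⟩
  have h3 := h2.sub h1
  rw [hD.of_ratio hM hm.ne_zero hD' hg hr, add_sub_cancel_left, sub_self] at h3
  exact h3.2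

theorem PrincipalDegreeZero.hasWeightedSum (hπ : PrincipalDegreeZero π) {M : C.Modules}
    (hM : IsLineBundle M) {U : C.Opens} [hU : Nonempty U] {m : Sec M U} (hm : IsGenerator m)
    {D : C → ℤ} (hD : IsDivisorOf m D) :
    HasWeightedSum (fun v => (π.residueDegree v : ℤ)) D (degree π M) := by
  have hex : ∃ d, HasDegree π M d := by
    refine ⟨∑ᶠ v : C, (π.residueDegree v : ℤ) * D v, ?_⟩
    intro V s hV hs D' hD'
    have : Nonempty V := Set.nonempty_coe_sort.mpr hV
    obtain ⟨g, hg⟩ := hm.exists_ratio s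
    have hg0 := hg.ne_zero_of_section hM hs
    have h1 : HasWeightedSum (fun v => (π.residueDegree v : ℤ)) D _ :=
      ⟨hD.support_finite hM, rfl⟩
    have h2 := h1.add (hπ g hg0)
    rw [← hD.of_ratio hM hm.ne_zero hD' hg0 hg, add_zero] at h2
    exact h2.2
  refine ⟨hD.support_finite hM, ?_⟩
  rw [degree, dif_pos hex]
  exact hex.choose_spec U m (Set.nonempty_coe_sort.mp hU) hm.ne_zero D hD

/-- The degree of a line bundle in terms of a rational generator and local generators. -/
theorem PrincipalDegreeZero.hasWeightedSum_ord (hπ : PrincipalDegreeZero π) {M : C.Modules}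
    (hM : IsLineBundle M) {U : C.Opens} [hU : Nonempty U] {m : Sec M U} (hm : IsGenerator m)
    (r : C → C.functionField)
    (hr : ∀ v : C, ∃ (W : C.Opens) (_ : v ∈ W) (l : Sec M W) (_ : IsGenerator l),
      IsRatio m l (r v)) :
    HasWeightedSum (fun v => (π.residueDegree v : ℤ)) (fun v => Scheme.ord (r v) v)
      (-degree π M) := by
  -- Here `r v` expresses the local generator through `m`, so `m` is `(r v)⁻¹` times it; hence the
  -- sign.
  have : IsDivisorOf m (-fun v => Scheme.ord (r v) v) := by
    refine isDivisorOf_of_exists _ _ fun v => ?_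
    obtain ⟨W, hv, l, hl, h⟩ := hr v
    have : Nonempty W := ⟨⟨v, hv⟩⟩
    have h0 := h.ne_zero hm hl
    exact ⟨W, hv, l, hl, _, h.symm hm hl, inv_ne_zero h0, (ord_inv h0 v).symm⟩
  simpa using (hπ.hasWeightedSum hM hm this).neg

/-- A nonzero `degree` cannot be the default value `0`, so a degree independent of the section
exists. -/
theorem principalDegreeZero_of_degree_ne_zero {M : C.Modules} (hM : IsLineBundle M)
    (h : degree π M ≠ 0) : PrincipalDegreeZero π := by
  rw [degree] at h
  split_ifs at h with hex
  · exact hex.choose_spec.principalDegreeZero hM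
  · exact absurd rfl h

end Degrees

end CurveBundle

/-! ### Adapted frames and their transition matrices -/

namespace CurveBundle

section FrameCoordinates

variable {C : Scheme.{u}} {M : C.Modules} {U : C.Opens} {ι : Type} [Fintype ι]

theorem IsFrame.coord_add {e : ι → Sec M U} (he : IsFrame e) (s t : Sec M U) :
    he.coord (s + t) = he.coord s + he.coord t := by
  refine he.coord_eq_of_sum_eq ?_
  simp only [Pi.add_apply, add_smul, Finset.sum_add_distrib, he.sum_coord]

theorem IsFrame.coord_smul {e : ι → Sec M U} (he : IsFrame e) (a : Fun C U) (s : Sec M U) :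
    he.coord (a • s) = a • he.coord s := by
  refine he.coord_eq_of_sum_eq ?_
  simp only [Pi.smul_apply, smul_eq_mul, mul_smul, ← Finset.smul_sum, he.sum_coord]

theorem IsFrame.coord_zero {e : ι → Sec M U} (he : IsFrame e) : he.coord (0 : Sec M U) = 0 :=
  he.coord_eq_of_sum_eq (by simp)

theorem IsFrame.coord_apply [DecidableEq ι] {e : ι → Sec M U} (he : IsFrame e) (i : ι) :
    he.coord (e i) = Pi.single i 1 :=
  he.coord_eq_of_sum_eq (by simp [Pi.single_apply])

theorem IsFrame.coord_sum {κ : Type*} {e : ι → Sec M U} (he : IsFrame e) (t : Finset κ)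
    (a : κ → Fun C U) (s : κ → Sec M U) (i : ι) :
    he.coord (∑ j ∈ t, a j • s j) i = ∑ j ∈ t, a j * he.coord (s j) i := by
  classical
  induction t using Finset.induction_on with
  | empty => simp [he.coord_zero]
  | insert j t hj ih =>
    rw [Finset.sum_insert hj, Finset.sum_insert hj, he.coord_add, Pi.add_apply, ih, he.coord_smul]
    rfl

end FrameCoordinates

section AdaptedFrames

variable {C : Scheme.{u}} {n : ℕ} {P : GSOBundle C n}

/-- A frame of `E` over `U` whose first members span the steps of the filtration and in which the
form is antidiagonal, together with generators of `L` and of `F`. -/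
structure AdaptedFrame (R : BorelReduction P) (F : C.Modules) (U : C.Opens) where
  e : Fin (2 * n + 2) → Sec P.E U
  frame : IsFrame e
  l : Sec P.L U
  l_gen : IsGenerator l
  φ : Sec F U
  φ_gen : IsGenerator φ
  flag : ∀ (i : Fin (n + 2)) (V : C.Opens) (h : V ≤ U), R.W i V =
    Submodule.span (Fun C V) {s | ∃ j : Fin (2 * n + 2), (j : ℕ) < (i : ℕ) ∧ s = res P.E h (e j)}
  form_eq : ∀ i j, P.form U (e i) (e j) = if j = i.rev then l else 0

variable {R : BorelReduction P} {F : C.Modules} {U V : C.Opens}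

/-- Restriction of an adapted frame. -/
noncomputable def AdaptedFrame.restrict (A : AdaptedFrame R F U) (h : V ≤ U) :
    AdaptedFrame R F V where
  e i := res P.E h (A.e i)
  frame := A.frame.restrict h
  l := res P.L h A.l
  l_gen := A.l_gen.restrict h
  φ := res F h A.φ
  φ_gen := A.φ_gen.restrict h
  flag i W hW := by simpa using A.flag i W (hW.trans h)
  form_eq i j := by
    rw [P.form_res, A.form_eq]
    split_ifs <;> simp

namespace AdaptedFrame

theorem mem_iff (A : AdaptedFrame R F U) (i : Fin (n + 2)) (s : Sec P.E U) :
    s ∈ R.W i U ↔ ∀ j : Fin (2 * n + 2), (i : ℕ) ≤ j → A.frame.coord s j = 0 := by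
  rw [A.flag i U le_rfl]
  constructor
  · intro hs
    induction hs using Submodule.span_induction with
    | mem s hs =>
      obtain ⟨j, hj, rfl⟩ := hs
      intro j' hj'
      rw [res_rfl, A.frame.coord_apply, Pi.single_apply, if_neg]
      rintro rfl
      lia
    | zero => simp [A.frame.coord_zero]
    | add s t _ _ hs ht =>
      intro j hj
      rw [A.frame.coord_add, Pi.add_apply, hs j hj, ht j hj, add_zero]
    | smul a s _ hs =>
      intro j hj
      rw [A.frame.coord_smul, Pi.smul_apply, hs j hj, smul_zero]
  · intro hs
    rw [← A.frame.sum_coord s]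
    refine Submodule.sum_mem _ fun j _ => ?_
    by_cases hj : (j : ℕ) < i
    · exact Submodule.smul_mem _ _ (Submodule.subset_span ⟨j, hj, by simp⟩)
    · rw [hs j (by lia), zero_smul]
      exact Submodule.zero_mem _

/-- The reversed frame is dual to the frame, so coordinates can be read off from the form. -/
theorem form_rev (A : AdaptedFrame R F U) (s : Sec P.E U) (i : Fin (2 * n + 2)) :
    P.form U s (A.e i.rev) = A.frame.coord s i • A.l := by
  conv_lhs => rw [← A.frame.sum_coord s]
  rw [map_sum, LinearMap.sum_apply, Finset.sum_eq_single i]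
  · rw [map_smul, LinearMap.smul_apply, A.form_eq, if_pos rfl]
  · intro j _ hj
    rw [map_smul, LinearMap.smul_apply, A.form_eq, if_neg (fun h => hj (Fin.rev_injective h).symm),
      smul_zero]
  · simp

/-- The transition matrix from the adapted frame `A` to the adapted frame `B`. -/
noncomputable def transition (A B : AdaptedFrame R F U) :
    Matrix (Fin (2 * n + 2)) (Fin (2 * n + 2)) (Fun C U) :=
  Matrix.of fun i j => A.frame.coord (B.e j) i

theorem sum_transition (A B : AdaptedFrame R F U) (j : Fin (2 * n + 2)) :
    ∑ i, A.transition B i j • A.e i = B.e j := A.frame.sum_coord _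

theorem e_mem (A : AdaptedFrame R F U) (j : Fin (2 * n + 2)) (i : Fin (n + 2)) (h : (j : ℕ) < i) :
    A.e j ∈ R.W i U := by
  rw [A.flag i U le_rfl]
  exact Submodule.subset_span ⟨j, h, by simp⟩

/-- The first `n+1` columns are triangular because both frames span the `W_i`. The others follow by
duality: the coefficient is a pairing with `A.e i.rev`, to which the first case applies with `A` and
`B` exchanged. -/
theorem transition_eq_zero (A B : AdaptedFrame R F U) {i j : Fin (2 * n + 2)} (hij : j < i) :
    A.transition B i j = 0 := by
  have key : ∀ (A B : AdaptedFrame R F U) {i j : Fin (2 * n + 2)}, j < i → (j : ℕ) < n + 1 →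
      A.frame.coord (B.e j) i = 0 := by
    intro A B i j hij hj
    exact (A.mem_iff ⟨j + 1, by lia⟩ _).mp (B.e_mem j _ (by simp)) i (by simp; lia)
  by_cases hj : (j : ℕ) < n + 1
  · exact key A B hij hj
  · refine A.l_gen.smul_injective ?_
    change A.frame.coord (B.e j) i • A.l = _
    rw [← A.form_rev, ← B.frame.sum_coord (A.e i.rev), map_sum, zero_smul]
    refine Finset.sum_eq_zero fun r _ => ?_
    rw [map_smul, B.form_eq]
    by_cases hr : r = j.rev
    · rw [hr, key B A (by rw [Fin.rev_lt_rev]; exact hij) (by rw [Fin.val_rev]; lia), zero_smul]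
    · rw [if_neg hr, smul_zero]

/-- This is the isomorphism `gr_j ⊗ gr_{j.rev} ≅ L` at the level of transition functions. -/
theorem transition_mul_transition_rev (A B : AdaptedFrame R F U) {w : Fun C U}
    (hw : w • A.l = B.l) (j : Fin (2 * n + 2)) :
    A.transition B j j * A.transition B j.rev j.rev = w := by
  refine A.l_gen.smul_injective ?_
  have h1 : P.form U (B.e j) (B.e j.rev) = B.l := by rw [B.form_eq, if_pos rfl]
  rw [hw, ← h1]
  conv_rhs => rw [← A.sum_transition B j.rev]
  rw [map_sum, Finset.sum_eq_single j.rev]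
  · rw [map_smul, A.form_rev, smul_smul, mul_comm]; rfl
  · intro i _ hi
    rw [map_smul]
    rcases lt_or_gt_of_ne hi with h | h
    · have : i = i.rev.rev := (Fin.rev_rev i).symm
      rw [this, A.form_rev]
      have h2 := A.transition_eq_zero B (i := i.rev) (j := j) (by rwa [Fin.lt_rev_iff])
      rw [show A.frame.coord (B.e j) i.rev = 0 from h2, zero_smul, smul_zero]
    · rw [A.transition_eq_zero B h, zero_smul]
  · simp

theorem matrix_persymmetric (A : AdaptedFrame R F U) (T : RegularSection P F)
    (i j : Fin (2 * n + 2)) :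
    T.matrix A.φ_gen A.frame i.rev j.rev = T.matrix A.φ_gen A.frame j i := by
  refine A.l_gen.smul_injective ?_
  change A.frame.coord _ _ • _ = A.frame.coord _ _ • _
  rw [← A.form_rev, ← A.form_rev, Fin.rev_rev, T.selfAdjoint, P.form_symm]

theorem matrix_restrict (A : AdaptedFrame R F U) (T : RegularSection P F) (h : V ≤ U)
    (i j : Fin (2 * n + 2)) :
    T.matrix (A.restrict h).φ_gen (A.restrict h).frame i j =
      resFun C h (T.matrix A.φ_gen A.frame i j) := by
  change (A.frame.restrict h).coord _ i = resFun C h (A.frame.coord _ i)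
  rw [← A.frame.coord_res h]
  congr 1
  exact T.endo_res _ _ h _ A.φ_gen _ _

theorem matrix_mul_transition (A B : AdaptedFrame R F U) (T : RegularSection P F) {w : Fun C U}
    (hw : w • A.φ = B.φ) :
    T.matrix A.φ_gen A.frame * A.transition B =
      w • (A.transition B * T.matrix B.φ_gen B.frame) := by
  -- Taking `B` apart lets its generator of `F` be replaced by `w • A.φ`, as `endo_smul` requires.
  obtain ⟨eB, fB, lB, lgB, φB, φgB, flB, foB⟩ := B
  subst hw
  ext i j
  have h1 : T.endo U A.φ A.φ_gen (eB j) = w • T.endo U (w • A.φ) φgB (eB j) := by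
    rw [← T.endo_smul U A.φ A.φ_gen w φgB]; rfl
  have h2 : A.frame.coord (T.endo U A.φ A.φ_gen (eB j)) i =
      (T.matrix A.φ_gen A.frame * Matrix.of fun i j => A.frame.coord (eB j) i) i j := by
    conv_lhs => rw [← A.frame.sum_coord (eB j)]
    rw [map_sum]
    simp only [map_smul]
    rw [A.frame.coord_sum, Matrix.mul_apply]
    exact Finset.sum_congr rfl fun r _ => mul_comm _ _
  have h3 : A.frame.coord (T.endo U (w • A.φ) φgB (eB j)) i =
      ((Matrix.of fun i j => A.frame.coord (eB j) i) * T.matrix φgB fB) i j := by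
    conv_lhs => rw [← fB.sum_coord (T.endo U (w • A.φ) φgB (eB j))]
    rw [A.frame.coord_sum, Matrix.mul_apply]
    exact Finset.sum_congr rfl fun r _ => mul_comm _ _
  rw [Matrix.smul_apply]
  refine h2.symm.trans ?_
  rw [h1, A.frame.coord_smul, Pi.smul_apply, h3]
  rfl

/-- The generator of the line bundle `X i` given by an adapted frame. -/
noncomputable def x (A : AdaptedFrame R F U) (i : Fin (n + 1)) : Sec (R.X i) U :=
  R.proj i U ⟨A.e (i.castLE (by lia)), A.e_mem _ _ (by simp)⟩

theorem proj_eq (A : AdaptedFrame R F U) (i : Fin (n + 1)) (s : R.W i.succ U) :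
    R.proj i U s = A.frame.coord s.1 (i.castLE (by lia)) • A.x i := by
  rw [x, ← sub_eq_zero, ← map_smul, ← map_sub, R.proj_eq_zero_iff, A.mem_iff]
  intro j hj
  have h1 : ∀ s t : Sec P.E U, A.frame.coord (s - t) j = A.frame.coord s j - A.frame.coord t j := by
    intro s t
    rw [eq_sub_iff_add_eq, ← Pi.add_apply, ← A.frame.coord_add, sub_add_cancel]
  rw [Submodule.coe_sub, Submodule.coe_smul, h1, A.frame.coord_smul, A.frame.coord_apply,
    Pi.smul_apply, Pi.single_apply]
  by_cases hji : j = i.castLE (by lia)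
  · subst hji; simp
  · rw [if_neg hji, (A.mem_iff i.succ s.1).mp s.2 j, smul_zero, sub_zero]
    have : (j : ℕ) ≠ i := fun h => hji (Fin.ext h)
    simp only [Fin.val_castSucc] at hj
    simp only [Fin.val_succ]
    lia

theorem x_restrict (A : AdaptedFrame R F U) (h : V ≤ U) (i : Fin (n + 1)) :
    (A.restrict h).x i = res (R.X i) h (A.x i) := by
  rw [x, x, ← R.proj_res]; rfl

/-- Surjectivity of `proj` holds only locally; the local coefficients are unique and therefore glue.
-/
theorem x_isGenerator (A : AdaptedFrame R F U) (i : Fin (n + 1)) : IsGenerator (A.x i) := by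
  have huniq : ∀ (V : C.Opens) (h : V ≤ U) (a b : Fun C V),
      a • res (R.X i) h (A.x i) = b • res (R.X i) h (A.x i) → a = b := by
    intro V h a b hab
    rw [← A.x_restrict h, ← sub_eq_zero, ← sub_smul, x, ← map_smul, R.proj_eq_zero_iff,
      (A.restrict h).mem_iff] at hab
    have := hab (i.castLE (by lia)) (by simp)
    rw [Submodule.coe_smul, IsFrame.coord_smul, IsFrame.coord_apply] at this
    simpa [sub_eq_zero] using this
  intro V h t
  obtain ⟨a, ha⟩ := exists_fun_of_local (U := V)
    (fun W hW a => a • res (R.X i) (hW.trans h) (A.x i) = res (R.X i) hW t)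
    (fun W W' hW hW' a ha => by
      have := congrArg (res (R.X i) hW') ha
      simpa using this)
    (fun W hW a b ha hb => huniq W (hW.trans h) a b (ha.trans hb.symm))
    (fun y hy => by
      obtain ⟨W, hW, hyW, s, hs⟩ := R.proj_surj i V t y hy
      exact ⟨W, hW, hyW, _, by
        rw [← hs, (A.restrict (hW.trans h)).proj_eq, x_restrict]⟩)
  refine ⟨a, ?_, fun b hb => ?_⟩
  · refine sec_ext fun y hy => ?_
    obtain ⟨W, hW, hyW, hp⟩ := ha y hy
    exact ⟨W, hW, hyW, by simpa using hp⟩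
  · refine huniq V h _ _ (hb.trans (sec_ext fun y hy => ?_).symm)
    obtain ⟨W, hW, hyW, hp⟩ := ha y hy
    exact ⟨W, hW, hyW, by simpa using hp⟩

theorem transition_smul_x (A B : AdaptedFrame R F U) (i : Fin (n + 1)) :
    A.transition B (i.castLE (by lia)) (i.castLE (by lia)) • A.x i = B.x i :=
  (A.proj_eq i ⟨B.e (i.castLE (by lia)), B.e_mem _ _ (by simp)⟩).symm

end AdaptedFrame

end AdaptedFrames

end CurveBundle

/-! ### Existence of adapted frames -/

namespace CurveBundle

section Isotropic

/-- A perfect symmetric form on a module with a basis whose first half spans an isotropic submodule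
can be brought into antidiagonal form without changing the first half. -/
theorem exists_block_antidiagonalization {R : Type*} [CommRing R] (h2 : IsUnit (2 : R)) {m : ℕ}
    (G : Matrix (Fin m ⊕ Fin m) (Fin m ⊕ Fin m) R) (hG : IsUnit G.det) (hsymm : G.transpose = G)
    (hiso : ∀ i j, G (.inl i) (.inl j) = 0) :
    ∃ Q Q' : Matrix (Fin m ⊕ Fin m) (Fin m ⊕ Fin m) R, Q * Q' = 1 ∧
      (∀ i j, Q i (.inl j) = if i = .inl j then 1 else 0) ∧
      Q.transpose * G * Q =
        Matrix.fromBlocks 0 (Matrix.of fun i j => if j = i.rev then 1 else 0)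
          (Matrix.of fun i j => if j = i.rev then 1 else 0) 0 := by
  set B := G.toBlocks₁₂ with hB
  set D := G.toBlocks₂₂ with hD
  have h11 : G.toBlocks₁₁ = 0 := by ext i j; exact hiso i j
  have h21 : G.toBlocks₂₁ = B.transpose := by
    ext i j
    exact congrFun (congrFun hsymm.symm (.inr i)) (.inl j)
  have hDs : D.transpose = D := by
    ext i j
    exact congrFun (congrFun hsymm (.inr i)) (.inr j)
  have hGb : G = Matrix.fromBlocks 0 B B.transpose D := by
    rw [← h11, ← h21, hB, hD, Matrix.fromBlocks_toBlocks]
  obtain ⟨Bi, hBi⟩ : ∃ Bi, B * Bi = 1 := by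
    refine ⟨G⁻¹.toBlocks₂₁, ?_⟩
    have h1 : G * G⁻¹ = 1 := Matrix.mul_nonsing_inv G hG
    rw [hGb] at h1
    conv_lhs at h1 => rw [← Matrix.fromBlocks_toBlocks (Matrix.fromBlocks 0 B B.transpose D)⁻¹]
    rw [Matrix.fromBlocks_multiply, ← Matrix.fromBlocks_one, Matrix.fromBlocks_inj] at h1
    rw [hGb]
    simpa using h1.1
  have hBi' : Bi * B = 1 := mul_eq_one_comm.mp hBi
  set J : Matrix (Fin m) (Fin m) R := Matrix.of fun i j => if j = i.rev then 1 else 0 with hJ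
  have hrev : ∀ i j : Fin m, i = j.rev ↔ j = i.rev := by
    intro i j
    rw [Fin.ext_iff, Fin.ext_iff, Fin.val_rev, Fin.val_rev]; lia
  have hJt : J.transpose = J := by
    ext i j
    simp only [hJ, Matrix.transpose_apply, Matrix.of_apply, hrev i j]
  have hJJ : J * J = 1 := by
    ext i j
    rw [Matrix.mul_apply, Finset.sum_eq_single i.rev]
    · simp [hJ, Matrix.one_apply, eq_comm]
    · intro r _ hr
      simp [hJ, hr]
    · simp
  obtain ⟨t, ht⟩ := h2.exists_right_inv
  set Z := Bi * J with hZ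
  have hBZ : B * Z = J := by rw [hZ, ← Matrix.mul_assoc, hBi, Matrix.one_mul]
  have hZB : Z.transpose * B.transpose = J := by
    rw [← Matrix.transpose_mul, hBZ, hJt]
  set S := Z.transpose * D * Z with hS
  have hSt : S.transpose = S := by
    simp only [hS, Matrix.transpose_mul, Matrix.transpose_transpose, hDs, Matrix.mul_assoc]
  set Y := (-t) • (J * S) with hY
  have hYt : Y.transpose = (-t) • (S * J) := by
    rw [hY, Matrix.transpose_smul, Matrix.transpose_mul, hSt, hJt]
  have hZZ : Z * (J * B) = 1 := by
    rw [hZ, Matrix.mul_assoc, ← Matrix.mul_assoc J, hJJ, Matrix.one_mul, hBi']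
  refine ⟨Matrix.fromBlocks 1 Y 0 Z, Matrix.fromBlocks 1 (-(Y * (J * B))) 0 (J * B), ?_, ?_, ?_⟩
  · rw [Matrix.fromBlocks_multiply, ← Matrix.fromBlocks_one]
    simp [hZZ]
  · rintro (i | i) j <;> simp [Matrix.one_apply]
  · rw [hGb, Matrix.fromBlocks_transpose, Matrix.fromBlocks_multiply, Matrix.fromBlocks_multiply]
    congr 1
    · simp
    · simpa using hBZ
    · simpa using hZB
    · have e1 : Z.transpose * B.transpose * Y = (-t) • S := by
        rw [hZB, hY, Matrix.mul_smul, ← Matrix.mul_assoc, hJJ, Matrix.one_mul]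
      have e2 : Y.transpose * B * Z = (-t) • S := by
        rw [Matrix.mul_assoc, hBZ, hYt, Matrix.smul_mul, Matrix.mul_assoc, hJJ, Matrix.mul_one]
      rw [Matrix.mul_zero, zero_add, Matrix.add_mul, e1, e2, ← hS]
      have : (-t + -t + 1) • S = 0 := by
        rw [show -t + -t + 1 = 0 by linear_combination -ht, zero_smul]
      rw [← this]; module

end Isotropic

section Existence

variable {C : Scheme.{u}} {n : ℕ} {P : GSOBundle C n}

theorem exists_adaptedFrame (h2 : ∀ U : C.Opens, IsUnit (2 : Fun C U)) (R : BorelReduction P)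
    {F : C.Modules} (hF : IsLineBundle F) (x : C) :
    ∃ U : C.Opens, x ∈ U ∧ Nonempty (AdaptedFrame R F U) := by
  obtain ⟨U₁, hx₁, e₁, he₁, hflag₁⟩ := R.adapted x
  obtain ⟨U₂, hx₂, l₂, hl₂⟩ := P.isLineBundle x
  obtain ⟨U₃, hx₃, φ₃, hφ₃⟩ := hF x
  set U := U₁ ⊓ U₂ ⊓ U₃
  have hU₁ : U ≤ U₁ := inf_le_left.trans inf_le_left
  have hU₂ : U ≤ U₂ := inf_le_left.trans inf_le_right
  have hU₃ : U ≤ U₃ := inf_le_right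
  refine ⟨U, ⟨⟨hx₁, hx₂⟩, hx₃⟩, ?_⟩
  set e := fun i => res P.E hU₁ (e₁ i) with he
  have hfr : IsFrame e := he₁.restrict hU₁
  have hl : IsGenerator (res P.L hU₂ l₂) := hl₂.restrict hU₂
  set l := res P.L hU₂ l₂
  have hflag : ∀ (i : Fin (n + 2)) (V : C.Opens) (h : V ≤ U), R.W i V =
      Submodule.span (Fun C V) {s | ∃ j : Fin (2 * n + 2), (j : ℕ) < (i : ℕ) ∧
        s = res P.E h (e j)} := by
    intro i V h
    simpa [he] using hflag₁ i V (h.trans hU₁)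
  -- Both halves are listed in increasing order, so the reversal inside the off-diagonal blocks
  -- becomes `Fin.rev` on all indices.
  let σ : Fin (n + 1) ⊕ Fin (n + 1) ≃ Fin (2 * n + 2) :=
    finSumFinEquiv.trans (finCongr (by lia))
  have hσl : ∀ i, (σ (.inl i) : ℕ) = i := fun i => by simp [σ]
  have hσr : ∀ i, (σ (.inr i) : ℕ) = n + 1 + i := fun i => by simp [σ, add_comm]
  set G := (P.gram e hl).submatrix σ σ with hG
  have hgram : ∀ i j, P.gram e hl i j • l = P.form U (e i) (e j) := fun i j => hl.coord_smul _
  obtain ⟨Q, Q', hQQ, hQl, hQG⟩ := exists_block_antidiagonalization (h2 U) G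
    (by rw [hG, Matrix.det_submatrix_equiv_self]; exact P.form_perfect U e l hfr hl)
    (by
      ext i j
      refine hl.smul_injective ?_
      simp only [hG, Matrix.transpose_apply, Matrix.submatrix_apply, hgram]
      exact P.form_symm _ _ _)
    (by
      intro i j
      refine hl.smul_injective ?_
      have hmem : ∀ i : Fin (n + 1), e (σ (.inl i)) ∈ R.W (Fin.last (n + 1)) U := by
        intro i
        rw [hflag _ U le_rfl]
        exact Submodule.subset_span ⟨σ (.inl i), by rw [hσl]; simp; lia, by simp⟩
      rw [hG, Matrix.submatrix_apply, hgram, R.isotropic U _ (hmem i) _ (hmem j), zero_smul])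
  set e' : Fin (2 * n + 2) → Sec P.E U :=
    fun j => ∑ i, (Q.submatrix σ.symm σ.symm) i j • e i with he'
  have hfr' : IsFrame e' := hfr.mul_matrix _ (Q'.submatrix σ.symm σ.symm) (by
    rw [Matrix.submatrix_mul_equiv, hQQ, Matrix.submatrix_one_equiv])
  have he'σ : ∀ j, e' (σ j) = ∑ i, Q i j • e (σ i) := by
    intro j
    simp only [he', Matrix.submatrix_apply, Equiv.symm_apply_apply]
    rw [← σ.sum_comp]
    simp
  have he'l : ∀ j : Fin (2 * n + 2), (j : ℕ) < n + 1 → e' j = e j := by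
    intro j hj
    have hj' : j = σ (.inl ⟨j, hj⟩) := Fin.ext (by rw [hσl])
    rw [hj', he'σ]
    simp [hQl]
  have hform : ∀ i j, P.form U (e' (σ i)) (e' (σ j)) =
      (Q.transpose * G * Q) i j • l := by
    intro i j
    rw [he'σ, he'σ, Matrix.mul_apply]
    simp only [map_sum, LinearMap.sum_apply, map_smul, LinearMap.smul_apply, ← hgram, smul_smul,
      ← Finset.sum_smul, Matrix.mul_apply, Finset.sum_mul, Matrix.transpose_apply]
    congr 1
    refine Finset.sum_congr rfl fun r _ => ?_
    rw [Finset.mul_sum]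
    refine Finset.sum_congr rfl fun s _ => ?_
    simp only [hG, Matrix.submatrix_apply]
    ring
  refine ⟨⟨e', hfr', l, hl, res F hU₃ φ₃, hφ₃.restrict hU₃, ?_, ?_⟩⟩
  · intro i V h
    rw [hflag i V h]
    congr 1
    ext s
    refine exists_congr fun j => and_congr_right fun hj => ?_
    rw [he'l j (by have := i.2; lia)]
  · intro i j
    obtain ⟨i, rfl⟩ := σ.surjective i
    obtain ⟨j, rfl⟩ := σ.surjective j
    rw [hform, hQG]
    rcases i with i | i <;> rcases j with j | j
    · rw [if_neg, Matrix.fromBlocks_apply₁₁, Matrix.zero_apply, zero_smul]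
      rw [Fin.ext_iff, Fin.val_rev, hσl, hσl]; lia
    · have : σ (.inr j) = (σ (.inl i)).rev ↔ j = i.rev := by
        rw [Fin.ext_iff, Fin.ext_iff, Fin.val_rev, Fin.val_rev, hσl, hσr]; lia
      simp only [Matrix.fromBlocks_apply₁₂, Matrix.of_apply, this, ite_smul, one_smul, zero_smul]
    · have : σ (.inl j) = (σ (.inr i)).rev ↔ j = i.rev := by
        rw [Fin.ext_iff, Fin.ext_iff, Fin.val_rev, Fin.val_rev, hσl, hσr]; lia
      simp only [Matrix.fromBlocks_apply₂₁, Matrix.of_apply, this, ite_smul, one_smul, zero_smul]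
    · rw [if_neg, Matrix.fromBlocks_apply₂₂, Matrix.zero_apply, zero_smul]
      rw [Fin.ext_iff, Fin.val_rev, hσr, hσr]; lia

end Existence

end CurveBundle

/-! ### Degrees of matrix entries and the conclusion -/

namespace CurveBundle

theorem discr_map_of_monic {R S : Type*} [CommRing R] [CommRing S] [Nontrivial S] (φ : R →+* S)
    {f : Polynomial R} (hf : f.Monic) (hdeg : 0 < f.natDegree) :
    (f.map φ).discr = φ f.discr := by
  have h1 := Polynomial.resultant_deriv (Polynomial.natDegree_pos_iff_degree_pos.mp hdeg)
  have h2 := Polynomial.resultant_deriv (f := f.map φ)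
    (Polynomial.natDegree_pos_iff_degree_pos.mp (by rwa [hf.natDegree_map]))
  rw [hf.natDegree_map, Polynomial.derivative_map, Polynomial.resultant_map_map, h1,
    (hf.map φ).leadingCoeff, hf.leadingCoeff] at h2
  simp only [mul_one, map_mul, map_pow, map_neg, map_one] at h2
  exact ((IsUnit.pow _ isUnit_one.neg).mul_left_cancel h2).symm

namespace AdaptedFrame

variable {C : Scheme.{u}} {n : ℕ} {P : GSOBundle C n} {R : BorelReduction P} {F : C.Modules}
  {U : C.Opens}

/-- The transformation of an entry of `T` when all other entries below and to the left of it
vanish. -/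
theorem matrix_corner (A B : AdaptedFrame R F U) (T : RegularSection P F) {w : Fun C U}
    (hw : w • A.φ = B.φ) {r s : Fin (2 * n + 2)}
    (hA : ∀ r' s', r ≤ r' → s' ≤ s → (r', s') ≠ (r, s) → T.matrix A.φ_gen A.frame r' s' = 0)
    (hB : ∀ r' s', r ≤ r' → s' ≤ s → (r', s') ≠ (r, s) → T.matrix B.φ_gen B.frame r' s' = 0) :
    T.matrix A.φ_gen A.frame r s * A.transition B s s =
      w * (A.transition B r r * T.matrix B.φ_gen B.frame r s) := by
  have h := congrFun (congrFun (A.matrix_mul_transition B T hw) r) s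
  rw [Matrix.smul_apply, Matrix.mul_apply, Matrix.mul_apply, Finset.sum_eq_single s,
    Finset.sum_eq_single r] at h
  · exact h
  · intro t _ ht
    rcases lt_or_gt_of_ne ht with hlt | hlt
    · rw [A.transition_eq_zero B hlt, zero_mul]
    · rw [hB t s hlt.le le_rfl (by simpa using ht), mul_zero]
  · simp
  · intro t _ ht
    rcases lt_or_gt_of_ne ht with hlt | hlt
    · rw [hA r t le_rfl hlt.le (by simpa using ht), zero_mul]
    · rw [A.transition_eq_zero B hlt, mul_zero]
  · simp

end AdaptedFrame

section FlagDegree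

variable {C : Scheme.{u}} [IsIntegral C] {k : Type u} [Field k]
  (π : C ⟶ Spec (.of k)) [LocallyOfFiniteType π] {n : ℕ} {P : GSOBundle C n}

/-- The degrees of the graded pieces of the complete flag
`W_1 ⊂ ⋯ ⊂ W_{n+1} = W_{n+1}^⊥ ⊂ W_n^⊥ ⊂ ⋯ ⊂ E`. -/
noncomputable def flagDegree (R : BorelReduction P) (j : ℕ) : ℤ :=
  if h : j < n + 1 then degree π (R.X ⟨j, h⟩)
  else degree π P.L - degree π (R.X ⟨2 * n + 1 - j, by lia⟩)

variable {π} {R : BorelReduction P}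

theorem flagDegree_sub_lt (f : ℤ)
    (hgap : ∀ i : Fin n, f < 2 * (degree π (R.X i.castSucc) - degree π (R.X i.succ)))
    (hlast : f < 2 * (2 * degree π (R.X (Fin.last n)) - degree π P.L)) (j : ℕ)
    (hj : j < 2 * n + 1) :
    f < 2 * (flagDegree π R j - flagDegree π R (j + 1)) := by
  have hX : ∀ a b : ℕ, ∀ (ha : a < n + 1) (hb : b < n + 1), a + 1 = b →
      f < 2 * (degree π (R.X ⟨a, ha⟩) - degree π (R.X ⟨b, hb⟩)) := by
    rintro a b ha hb rfl
    exact hgap ⟨a, by lia⟩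
  rcases lt_trichotomy j n with h | rfl | h
  · rw [flagDegree, flagDegree, dif_pos (by lia), dif_pos (by lia)]
    exact hX _ _ _ _ rfl
  -- The middle step from `X_n` to its dual twisted by `L` drops by `2 deg X_n - deg L`; the steps
  -- after it mirror those before.
  · rw [flagDegree, flagDegree, dif_pos (by lia), dif_neg (by lia)]
    have h1 : (⟨2 * j + 1 - (j + 1), by lia⟩ : Fin (j + 1)) = ⟨j, by lia⟩ := Fin.ext (by simp; lia)
    rw [h1]
    have h2 : (⟨j, by lia⟩ : Fin (j + 1)) = Fin.last j := rfl
    rw [h2]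
    lia
  · rw [flagDegree, flagDegree, dif_neg (by lia), dif_neg (by lia)]
    have := hX (2 * n + 1 - (j + 1)) (2 * n + 1 - j) (by lia) (by lia) (by lia)
    lia

end FlagDegree

section Entries

variable {C : Scheme.{u}} [IsIntegral C] [IsNoetherian C] {k : Type u} [Field k]
  {π : C ⟶ Spec (.of k)} [LocallyOfFiniteType π] {n : ℕ} {P : GSOBundle C n}
  {R : BorelReduction P} {F : C.Modules}

/-- Vanishing of the corner in all frames makes the entry transform by scalars only, as a section of
`Hom(gr_s, gr_r) ⊗ F`; `D` is its divisor. -/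
theorem hasWeightedSum_matrix_entry (hπ : PrincipalDegreeZero π) (hF : IsLineBundle F)
    (hex : ∀ x : C, ∃ U : C.Opens, x ∈ U ∧ Nonempty (AdaptedFrame R F U))
    (T : RegularSection P F) {r s : Fin (2 * n + 2)}
    (hcorner : ∀ (U : C.Opens) [Nonempty U] (A : AdaptedFrame R F U) (r' s' : Fin (2 * n + 2)),
      r ≤ r' → s' ≤ s → (r', s') ≠ (r, s) → T.matrix A.φ_gen A.frame r' s' = 0)
    {U₀ : C.Opens} [Nonempty U₀] (A₀ : AdaptedFrame R F U₀)
    (h0 : T.matrix A₀.φ_gen A₀.frame r s ≠ 0) :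
    ∃ D : C → ℤ, HasWeightedSum (fun v => (π.residueDegree v : ℤ)) D
        (degree π F + flagDegree π R r - flagDegree π R s) ∧
      ∀ v, ∃ (U : C.Opens) (_ : v ∈ U) (_ : Nonempty U) (A : AdaptedFrame R F U),
        D v = Scheme.ord (C.germToFunctionField U (T.matrix A.φ_gen A.frame r s)) v := by
  choose U hU hA using hex
  let A : ∀ v, AdaptedFrame R F (U v) := fun v => (hA v).some
  have hne : ∀ v, Nonempty (U v) := fun v => ⟨⟨v, hU v⟩⟩
  have hneV : ∀ v, Nonempty (U₀ ⊓ U v : C.Opens) := fun v => nonempty_inf U₀ (U v)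
  let A' : ∀ v, AdaptedFrame R F (U₀ ⊓ U v) := fun v => A₀.restrict inf_le_left
  let B' : ∀ v, AdaptedFrame R F (U₀ ⊓ U v) := fun v => (A v).restrict inf_le_right
  choose w hw using fun v => (A' v).φ_gen.exists_smul_eq (B' v).φ
  choose c hc using fun v => (A' v).l_gen.exists_smul_eq (B' v).l
  let γ : ∀ v, Fun C (U₀ ⊓ U v) →+* C.functionField := fun v =>
    (C.germToFunctionField (U₀ ⊓ U v)).hom
  -- `G v j` is the ratio of the generators of `gr_j` given by the frame at `v` and by the fixed
  -- frame `A₀`.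
  let G : C → Fin (2 * n + 2) → C.functionField := fun v j => γ v ((A' v).transition (B' v) j j)
  have hwr : ∀ v, IsRatio A₀.φ (A v).φ (γ v (w v)) := fun v =>
    ⟨_, inf_le_left, inf_le_right, hneV v, w v, hw v, rfl⟩
  have hcr : ∀ v, IsRatio A₀.l (A v).l (γ v (c v)) := fun v =>
    ⟨_, inf_le_left, inf_le_right, hneV v, c v, hc v, rfl⟩
  have hw0 : ∀ v, γ v (w v) ≠ 0 := fun v => (hwr v).ne_zero A₀.φ_gen (A v).φ_gen
  have hc0 : ∀ v, γ v (c v) ≠ 0 := fun v => (hcr v).ne_zero A₀.l_gen (A v).l_gen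
  have hGrev : ∀ v j, G v j * G v j.rev = γ v (c v) := fun v j => by
    rw [← (A' v).transition_mul_transition_rev (B' v) (hc v) j, map_mul]
  have hG0 : ∀ v j, G v j ≠ 0 := fun v j => left_ne_zero_of_mul (by rw [hGrev]; exact hc0 v)
  have hwsum := hπ.hasWeightedSum_ord hF A₀.φ_gen (fun v => γ v (w v)) fun v =>
    ⟨U v, hU v, (A v).φ, (A v).φ_gen, hwr v⟩
  have hcsum := hπ.hasWeightedSum_ord P.isLineBundle A₀.l_gen (fun v => γ v (c v)) fun v =>
    ⟨U v, hU v, (A v).l, (A v).l_gen, hcr v⟩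
  have hXsum : ∀ i : Fin (n + 1), HasWeightedSum (fun v => (π.residueDegree v : ℤ))
      (fun v => Scheme.ord (G v (i.castLE (by lia))) v) (-degree π (R.X i)) := fun i =>
    hπ.hasWeightedSum_ord (R.isLineBundle i) (A₀.x_isGenerator i) _ fun v =>
      ⟨U v, hU v, (A v).x i, (A v).x_isGenerator i, _, inf_le_left, inf_le_right, hneV v, _, by
        have := (A' v).transition_smul_x (B' v) i
        rwa [AdaptedFrame.x_restrict, AdaptedFrame.x_restrict] at this, rfl⟩
  have hGsum : ∀ j : Fin (2 * n + 2), HasWeightedSum (fun v => (π.residueDegree v : ℤ))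
      (fun v => Scheme.ord (G v j) v) (-flagDegree π R j) := by
    intro j
    rw [flagDegree]
    split_ifs with hj
    · exact hXsum ⟨j, hj⟩
    · have h1 := hcsum.sub (hXsum ⟨2 * n + 1 - j, by lia⟩)
      have h2 : (⟨2 * n + 1 - j, by lia⟩ : Fin (n + 1)).castLE (by lia) = j.rev :=
        Fin.ext (by simp only [Fin.val_castLE, Fin.val_rev]; lia)
      rw [h2] at h1
      convert h1 using 1
      · ext v
        rw [Pi.sub_apply, ← hGrev v j, Scheme.ord_mul (hG0 v j) (hG0 v j.rev)]
        ring
      · ring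
  set a := C.germToFunctionField U₀ (T.matrix A₀.φ_gen A₀.frame r s) with ha
  have ha0 : a ≠ 0 := by
    rwa [ha, Ne, map_eq_zero_iff _ (C.germToFunctionField_injective U₀)]
  let b : C → C.functionField := fun v =>
    C.germToFunctionField (U v) (T.matrix (A v).φ_gen (A v).frame r s)
  -- Taking orders at `v` and summing over `v` gives the degree, since `a` is one fixed rational
  -- function and contributes zero.
  have hrel : ∀ v, a * G v s = γ v (w v) * (G v r * b v) := by
    intro v
    have h1 := congrArg (γ v) ((A' v).matrix_corner (B' v) T (hw v) (hcorner _ (A' v))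
      (hcorner _ (B' v)))
    rw [AdaptedFrame.matrix_restrict, AdaptedFrame.matrix_restrict, map_mul, map_mul, map_mul] at h1
    have h2 : γ v (resFun C inf_le_left (T.matrix A₀.φ_gen A₀.frame r s)) = a :=
      germToFunctionField_resFun _ _
    have h3 : γ v (resFun C inf_le_right (T.matrix (A v).φ_gen (A v).frame r s)) = b v :=
      germToFunctionField_resFun _ _
    rwa [h2, h3] at h1
  have hb0 : ∀ v, b v ≠ 0 := by
    intro v hb
    have := hrel v
    rw [hb, mul_zero, mul_zero] at this
    exact mul_ne_zero ha0 (hG0 v s) this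
  refine ⟨fun v => Scheme.ord (b v) v, ?_, fun v => ⟨U v, hU v, hne v, A v, rfl⟩⟩
  convert (((hπ a ha0).add (hGsum s)).sub hwsum).sub (hGsum r) using 1
  · ext v
    have := congrArg (fun g => Scheme.ord g v) (hrel v)
    simp only [Scheme.ord_mul ha0 (hG0 v s),
      Scheme.ord_mul (hw0 v) (mul_ne_zero (hG0 v r) (hb0 v)),
      Scheme.ord_mul (hG0 v r) (hb0 v)] at this
    simp only [Pi.sub_apply, Pi.add_apply]
    lia
  · ring

theorem matrix_hessenberg (hπ : PrincipalDegreeZero π) (hF : IsLineBundle F)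
    (hex : ∀ x : C, ∃ U : C.Opens, x ∈ U ∧ Nonempty (AdaptedFrame R F U))
    (T : RegularSection P F)
    (hneg : ∀ r s : Fin (2 * n + 2), (s : ℕ) + 2 ≤ r →
      degree π F + flagDegree π R r - flagDegree π R s < 0)
    (r s : Fin (2 * n + 2)) (hrs : (s : ℕ) + 2 ≤ r) (U : C.Opens) [Nonempty U]
    (A : AdaptedFrame R F U) : T.matrix A.φ_gen A.frame r s = 0 := by
  -- Induction outward from the lower left corner, over all open sets and frames at once. A nonzero
  -- entry would have an effective divisor of negative degree.
  induction hm : 2 * n + 2 - (r : ℕ) + s using Nat.strong_induction_on generalizing r s U with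
  | _ m ih =>
    by_contra h0
    obtain ⟨D, hD, hDv⟩ := hasWeightedSum_matrix_entry hπ hF hex T (r := r) (s := s)
      (fun U' _ A' r' s' hr hs hne => by
        have h1 : (r : ℕ) ≤ r' := hr
        have h2 : (s' : ℕ) ≤ s := hs
        have h3 : ¬ ((r' : ℕ) = r ∧ (s' : ℕ) = s) := fun h =>
          hne (Prod.ext (Fin.ext h.1) (Fin.ext h.2))
        exact ih _ (by lia) r' s' (by lia) U' A' rfl) A h0
    refine absurd (hD.nonneg (fun v => by positivity) fun v => ?_) (not_le.mpr (hneg r s hrs))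
    obtain ⟨U', hv, hne, A', h⟩ := hDv v
    rw [h]
    exact ord_germ_nonneg _ hv

/-- A divisor of nonzero degree is nonzero somewhere, and orders vanish away from codimension one.
-/
theorem exists_coheight_eq_one (hF : IsLineBundle F) (hF0 : degree π F ≠ 0) :
    ∃ v : C, Order.coheight v = 1 := by
  obtain ⟨U, hU, m, hm⟩ := exists_generator_nonempty hF
  obtain ⟨D, hD⟩ := hF.exists_divisor hm.ne_zero
  obtain ⟨v, hv⟩ := ((principalDegreeZero_of_degree_ne_zero hF hF0).hasWeightedSum hF hm
    hD).exists_ne_zero hF0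
  refine ⟨v, ?_⟩
  by_contra h
  obtain ⟨W, hvW, l, hl⟩ := hF v
  have : Nonempty W := ⟨⟨v, hvW⟩⟩
  obtain ⟨r, hr⟩ := hl.exists_ratio m
  rw [(isDivisorOf_iff m D).mp hD v W hvW l hl r hr] at hv
  exact hv (Scheme.ord_eq_zero_of_coheight_neq_one h r)

/-- Some subdiagonal entry of `T` vanishes at some point of codimension one. -/
theorem exists_subdiagonal_mem_maximalIdeal (hF : IsLineBundle F) (hF0 : degree π F ≠ 0)
    (hex : ∀ x : C, ∃ U : C.Opens, x ∈ U ∧ Nonempty (AdaptedFrame R F U))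
    (T : RegularSection P F)
    (hneg : ∀ r s : Fin (2 * n + 2), (s : ℕ) + 2 ≤ r →
      degree π F + flagDegree π R r - flagDegree π R s < 0)
    (hpos : 0 < (2 * n + 1) * degree π F + flagDegree π R (2 * n + 1) - flagDegree π R 0) :
    ∃ v : C, Order.coheight v = 1 ∧ ∃ (U : C.Opens) (hv : v ∈ U) (A : AdaptedFrame R F U)
      (r s : Fin (2 * n + 2)), (s : ℕ) + 1 = r ∧
        C.presheaf.germ U v hv (T.matrix A.φ_gen A.frame r s) ∈
          IsLocalRing.maximalIdeal (C.presheaf.stalk v) := by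
  have hπ := principalDegreeZero_of_degree_ne_zero hF hF0
  obtain ⟨v₀, hv₀⟩ := exists_coheight_eq_one (π := π) hF hF0
  obtain ⟨U₀, hvU₀, ⟨A₀⟩⟩ := hex v₀
  have : Nonempty U₀ := ⟨⟨v₀, hvU₀⟩⟩
  -- The degrees of the subdiagonal entries telescope to the positive quantity in `hpos`.
  obtain ⟨i, hi, hipos⟩ : ∃ i < 2 * n + 1,
      0 < degree π F + flagDegree π R (i + 1) - flagDegree π R i := by
    by_contra! h
    have h1 := Finset.sum_nonpos fun i (hi : i ∈ Finset.range (2 * n + 1)) =>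
      h i (Finset.mem_range.mp hi)
    simp only [add_sub_assoc] at h1
    rw [Finset.sum_add_distrib, Finset.sum_range_sub] at h1
    simp only [Finset.sum_const, Finset.card_range, nsmul_eq_mul] at h1
    push_cast at h1
    lia
  set r : Fin (2 * n + 2) := ⟨i + 1, by lia⟩ with hr
  set s : Fin (2 * n + 2) := ⟨i, by lia⟩ with hs
  -- If the entry is zero in this frame, the chosen point `v₀` already works.
  by_cases h0 : T.matrix A₀.φ_gen A₀.frame r s = 0
  · exact ⟨v₀, hv₀, U₀, hvU₀, A₀, r, s, rfl, by rw [h0, map_zero]; exact Ideal.zero_mem _⟩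
  obtain ⟨D, hD, hDv⟩ := hasWeightedSum_matrix_entry hπ hF hex T (r := r) (s := s)
    (fun U' _ A' r' s' hr' hs' hne => by
      have h1 : i + 1 ≤ (r' : ℕ) := hr'
      have h2 : (s' : ℕ) ≤ i := hs'
      have h3 : ¬ ((r' : ℕ) = i + 1 ∧ (s' : ℕ) = i) := fun h =>
        hne (Prod.ext (Fin.ext h.1) (Fin.ext h.2))
      exact matrix_hessenberg hπ hF hex T hneg r' s' (by lia) U' A') A₀ h0
  obtain ⟨v, hv⟩ := hD.exists_ne_zero hipos.ne'
  obtain ⟨U, hvU, hne, A, h⟩ := hDv v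
  rw [h] at hv
  refine ⟨v, ?_, U, hvU, A, r, s, rfl, ?_⟩
  · by_contra hc
    exact hv (Scheme.ord_eq_zero_of_coheight_neq_one hc _)
  · exact germ_mem_maximalIdeal_of_ord_pos _ hvU
      (lt_of_le_of_ne (ord_germ_nonneg _ hvU) (Ne.symm hv))

theorem not_hasSquarefreeDiscriminant (hn : 1 ≤ n) (hF : IsLineBundle F) (hF0 : degree π F ≠ 0)
    (hex : ∀ x : C, ∃ U : C.Opens, x ∈ U ∧ Nonempty (AdaptedFrame R F U))
    (hneg : ∀ r s : Fin (2 * n + 2), (s : ℕ) + 2 ≤ r →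
      degree π F + flagDegree π R r - flagDegree π R s < 0)
    (hpos : 0 < (2 * n + 1) * degree π F + flagDegree π R (2 * n + 1) - flagDegree π R 0)
    (T : RegularSection P F) : ¬ T.HasSquarefreeDiscriminant := by
  intro hT
  obtain ⟨v, hv, U, hvU, A, r, s, hrs, hmem⟩ :=
    exists_subdiagonal_mem_maximalIdeal hF hF0 hex T hneg hpos
  have : Nonempty U := ⟨⟨v, hvU⟩⟩
  refine hT v hv U hvU A.φ A.φ_gen A.e A.frame ?_
  have hπ := principalDegreeZero_of_degree_ne_zero hF hF0
  set M := T.matrix A.φ_gen A.frame with hM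
  let g := (C.presheaf.germ U v hvU).hom
  have h1 : g M.charpoly.discr = (M.map g).charpoly.discr := by
    rw [Matrix.charpoly_map, discr_map_of_monic g M.charpoly_monic]
    rw [Matrix.charpoly_natDegree_eq_dim]
    simp
  change g M.charpoly.discr ∈ _
  rw [h1]
  refine discr_charpoly_mem_sq (by lia) (M.map g) (fun i j hij => ?_) (fun i j => ?_) r s hrs hmem
  · rw [Matrix.map_apply, hM, matrix_hessenberg hπ hF hex T hneg i j hij U A, map_zero]
  · rw [Matrix.map_apply, hM, A.matrix_persymmetric, Matrix.map_apply]

/-- In characteristic different from two, two is invertible in all rings of regular functions. -/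
theorem isUnit_two {k : Type u} [Field k] {C : Scheme.{u}} (π : C ⟶ Spec (.of k))
    (h : (2 : k) ≠ 0) (U : C.Opens) : IsUnit (2 : Fun C U) := by
  let ρ : k →+* Fun C U := ((Scheme.ΓSpecIso (.of k)).inv ≫ π.appTop ≫
    C.presheaf.map (homOfLE (le_top : U ≤ ⊤)).op).hom
  have := (isUnit_iff_ne_zero.mpr h).map ρ
  rwa [map_ofNat] at this

end Entries

end CurveBundle

theorem mainTheorem11 {k : Type u} [Field k] [Finite k] (p : ℕ) [CharP k p]
    (n : ℕ) (hn : 1 ≤ n) (hp : 4 * n < p)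
    {C : Scheme.{u}} [IsIntegral C] (π : C ⟶ Spec (.of k))
    [SmoothOfRelativeDimension 1 π] [IsProper π] [GeometricallyConnected π]
    (hpoint : ∃ σ : Spec (.of k) ⟶ C, σ ≫ π = 𝟙 (Spec (.of k)))
    (P : CurveBundle.GSOBundle C n) (R : CurveBundle.BorelReduction P) (hR : R.IsCanonical π)
    (F : C.Modules) (hF : CurveBundle.IsLineBundle F)
    (d f : ℤ) (hd : CurveBundle.degree π P.L = d) (hf : CurveBundle.degree π F = f)
    (μ : Fin (n + 1) → ℤ) (hμ : ∀ i, CurveBundle.degree π (R.X i) = μ i)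
    (hgap : ∀ i : Fin n,
      (f : ℚ) / 2 < μ i.castSucc - μ i.succ ∧ μ i.castSucc - μ i.succ ≤ f)
    (hlast : (f : ℚ) / 2 < 2 * μ (Fin.last n) - d ∧ 2 * μ (Fin.last n) - d ≤ f)
    (htop : 2 * μ 0 - d < (2 * n + 1) * f) :
    (∀ T : CurveBundle.RegularSection P F, ¬ T.HasSquarefreeDiscriminant) ∧
      {T : CurveBundle.RegularSection P F | T.HasSquarefreeDiscriminant}.encard = 0 := by
  suffices h : ∀ T : CurveBundle.RegularSection P F, ¬ T.HasSquarefreeDiscriminant by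
    refine ⟨h, ?_⟩
    rw [Set.encard_eq_zero, Set.eq_empty_iff_forall_notMem]
    exact h
  have : IsLocallyNoetherian C := LocallyOfFiniteType.isLocallyNoetherian π
  have : CompactSpace C := QuasiCompact.compactSpace_of_compactSpace π
  have : IsNoetherian C := {}
  have h2 : (2 : k) ≠ 0 := by
    intro h
    have := (CharP.cast_eq_zero_iff k p 2).mp (by exact_mod_cast h)
    have := Nat.le_of_dvd (by lia) this
    lia
  have hlast' : f < 2 * (2 * μ (Fin.last n) - d) := by
    have := hlast.1
    rw [div_lt_iff₀ (by norm_num)] at this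
    have h3 : f < (2 * μ (Fin.last n) - d) * 2 := by exact_mod_cast this
    lia
  have hgap' : ∀ i : Fin n, f < 2 * (μ i.castSucc - μ i.succ) := by
    intro i
    have := (hgap i).1
    rw [div_lt_iff₀ (by norm_num)] at this
    have h3 : f < (μ i.castSucc - μ i.succ) * 2 := by exact_mod_cast this
    lia
  -- From `f/2 < 2μ_{n+1} - d ≤ f`.
  have hf0 : 0 < f := by have := hlast.2; lia
  have hstep := CurveBundle.flagDegree_sub_lt (π := π) (R := R) f (by simpa only [hμ] using hgap')
    (by simpa only [hμ, hd] using hlast')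
  -- Two drops of more than `f/2` already exceed `f`, and since `f > 0` further drops only help.
  have hmono : ∀ m j : ℕ, j + 2 + m ≤ 2 * n + 1 →
      f < CurveBundle.flagDegree π R j - CurveBundle.flagDegree π R (j + 2 + m) := by
    intro m j hj
    induction m with
    | zero =>
      have h3 := hstep j (by lia)
      have h4 := hstep (j + 1) (by lia)
      simp only [add_zero]
      lia
    | succ m ih =>
      have h3 := hstep (j + 2 + m) (by lia)
      have h4 := ih (by lia)
      rw [← add_assoc]
      lia
  refine CurveBundle.not_hasSquarefreeDiscriminant (π := π) (R := R) hn hF (by rw [hf]; lia)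
    (CurveBundle.exists_adaptedFrame (CurveBundle.isUnit_two π h2) R hF) ?_ ?_
  · intro r s hrs
    obtain ⟨m, hm⟩ := Nat.exists_eq_add_of_le hrs
    have := hmono m s (by have := r.2; lia)
    rw [hm, hf]
    lia
  · have h3 : CurveBundle.flagDegree π R 0 = μ 0 := by
      rw [CurveBundle.flagDegree, dif_pos (by lia), hμ]; rfl
    have h4 : CurveBundle.flagDegree π R (2 * n + 1) = d - μ 0 := by
      rw [CurveBundle.flagDegree, dif_neg (by lia), hd, hμ]
      congr 2
      exact Fin.ext (by simp)
    rw [h3, h4, hf]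
    lia
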